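/- Let $X\in\{B,D\}$ and let $\mathfrak g=\mathfrak o(\infty)$ be the orthogonal Lie algebra over $\mathbb C$ of finitary skew endomorphisms of the space with basis $e_{\pm i}$ $(i\in\mathbb Z_{>0})$, together with $e_0$ if $X=B$, and form $(e_a,e_b)=\delta_{a,-b}$. Let $\mathfrak h$ be its diagonal Cartan subalgebra, $\varepsilon_a\in\mathfrak h^*$ the weight of $e_a$ (so $\varepsilon_{-i}=-\varepsilon_i$, $\varepsilon_0=0$), and $\Delta$ its set of roots, all of the form $\varepsilon_a-\varepsilon_b$. For $A\subseteq\mathbb Z_{>0}$ let $\omega_A$ be the weight with coordinates $\tfrac12$ on $A$ and $-\tfrac12$ off $A$; write $A'\sim_B A$ if $A',A$ differ by finitely many elements and $A'\sim_D A$ if they differ by a finite even number of elements. Let $\mathcal S_A=\mathcal S_A^X$ be the spinor $\mathfrak g$-module with support $\{\omega_{A'}: A'\sim_X A\}$, that is, the direct limit of finite-dimensional spinor modules $\mathcal S_n$ of $\mathfrak o(2n+1)$ (resp. half-spinor modules of $\mathfrak o(2n)$) in which the vectors of weight $\omega_{A\cap\{1,\dots,n\}}\in\mathbb C^n$ are mapped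 to each other. Let $\prec$ be a strict partial order on $\mathbb Z$ that is reversed by multiplication by $-1$ and admissible: with $[i]:=\{i\}\cup\{j: j\text{ not comparable with }i\}$, any two of the sets $[i],[j]$ are equal or disjoint. If $X=D$, assume that whenever some $i\neq0$ is not comparable with $0$, some $j\notin\{0,i,-i\}$ is not comparable with $0$ either. Put $\varepsilon_a-\varepsilon_b\succ0$ iff $a\prec b$; let $P^+$ be the set of roots $\alpha\succ0$ and $P^0$ the set of roots $\alpha$ with neither $\alpha\succ 0$ nor $-\alpha\succ 0$. Let $\mathfrak u(\prec)$ be generated by the root spaces of $P^+$, $\mathfrak l(\prec)$ by $\mathfrak h$ and the root spaces of $P^0$, $\mathfrak p(\prec)$ by $\mathfrak h$ and the root spaces of $P^0\cup P^+$, and $\mathfrak l(\prec)^{ss}=[\mathfrak l(\prec),\mathfrak l(\prec)]$. Let $\mathfrak g[p]$ be generated by the root spaces of the roots $\varepsilon_a-\varepsilon_b$ with $a,b\in[p]$; write $\mathfrak o([0])=\mathfrak g[0]$ and $\mathfrak{sl}(\prec)=\sum_{[p]\ne[0]}\mathfrak g[p]$ (the sum of the type-$A$ components). Put $J=[0]\cap\mathbb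 Z_{>0}$. Call $A'\subseteq\mathbb Z_{>0}$ compatible with $\prec$ if $k\prec0$ or $k\in[0]$ for all $k\in A'$, and $0\prec k$ or $k\in[0]$ for all $k\in\mathbb Z_{>0}\setminus A'$. Suppose that $\mathcal S_A$ is $\mathfrak p(\prec)$-aligned, i.e. it is the simple quotient of a generalized Verma module $U(\mathfrak g)\otimes_{U(\mathfrak p(\prec))}S$ with $S$ a simple weight $\mathfrak l(\prec)$-module and $\mathfrak u(\prec)S=0$; or suppose only that $(\mathcal S_A)^{\mathfrak u(\prec)}\neq0$. If $X=D$ and $[0]=\{0\}$, suppose in addition that $\prec$ is compatible with some $A'\sim_D A$. Then: 1. there is $A'\sim_X A$ compatible with $\prec$, and $\mathfrak{sl}(\prec)\cdot(\mathcal S_A)^{\mathfrak u(\prec)}=0$; 2. $\mathfrak l(\prec)^{ss}=\mathfrak o([0])\oplus\mathfrak{sl}(\prec)$ as Lie algebras, and for every $A'\sim_X A$ compatible with $\prec$, with $A'_{[0]}=A'\cap J$, there is an isomorphism of $\mathfrak l(\prec)^{ss}$-modules as follows, where $\mathfrak{sl}(\prec)$ acts trivially on the factor $\mathbb C$ and $\mathfrak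 o([0])$ is identified with the orthogonal algebra of type $X$ with index set $\{1,\dots,n\}$ or $\mathbb Z_{>0}$ by the increasing enumeration of $J$: (a) if $X=B$ and $|J|=n<\infty$, then $\mathfrak o([0])\cong\mathfrak o(2n+1)$ and $(\mathcal S_A)^{\mathfrak u(\prec)}\cong\mathcal S_n\boxtimes\mathbb C$; (b) if $X=D$ and $|J|=n<\infty$, then $\mathfrak o([0])\cong\mathfrak o(2n)$ and $(\mathcal S_A)^{\mathfrak u(\prec)}\cong\mathcal S_n^+\boxtimes\mathbb C$ if $|J\setminus A'|$ is even, $\cong\mathcal S_n^-\boxtimes\mathbb C$ if $|J\setminus A'|$ is odd, where $\mathcal S_n^{\pm}$ has highest weight $(\tfrac12,\dots,\tfrac12,\pm\tfrac12)$ (and $\mathcal S_0^+=\mathbb C$); (c) if $J$ is infinite, then $\mathfrak o([0])\cong\mathfrak o(\infty)$ of type $X$ and $(\mathcal S_A)^{\mathfrak u(\prec)}\cong\mathcal S^X_{A'_{[0]}}\boxtimes\mathbb C$. -/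

import Mathlib

noncomputable section

set_option linter.unusedSimpArgs false
set_option linter.unusedSectionVars false

attribute [local instance] LieRing.ofAssociativeRing

namespace OInf

/-- The two families of root embeddings defining `o(∞)`. -/
inductive SpinType
  | B
  | D

/-- Index set of the basis `e_i, e_{-i}` (and `e_0` in type `B`) of the natural module. -/
inductive Idx (T : SpinType) (ι : Type) : Type
  | pos (i : ι) : Idx T ι
  | neg (i : ι) : Idx T ι
  | zero (h : T = SpinType.B) : Idx T ι

variable {T : SpinType} {ι κ : Type}

/-- The sign change `a ↦ -a` of indices. -/
def Idx.opp : Idx T ι → Idx T ι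
  | .pos i => .neg i
  | .neg i => .pos i
  | .zero h => .zero h

theorem Idx.opp_opp (a : Idx T ι) : a.opp.opp = a := by
  cases a <;> rfl

/-- The natural module `V`, with basis `e_a = Finsupp.single a 1`. -/
abbrev NatMod (T : SpinType) (ι : Type) : Type := Idx T ι →₀ ℂ

/-- The symmetric bilinear form on `V` with `(e_a, e_b) = 1` if `b = -a` and `0` otherwise. -/
def form (T : SpinType) (ι : Type) : LinearMap.BilinForm ℂ (NatMod T ι) :=
  Finsupp.linearCombination ℂ (fun a : Idx T ι => (Finsupp.lapply a.opp : NatMod T ι →ₗ[ℂ] ℂ))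

theorem form_single (a : Idx T ι) (w : NatMod T ι) : form T ι (Finsupp.single a 1) w = w a.opp := by
  simp [form]

theorem form_comm (v w : NatMod T ι) : form T ι v w = form T ι w v := by
  have : form T ι = (form T ι).flip := by
    ext a b
    classical
    simp [form, Finsupp.single_apply]
    have : b = a.opp ↔ a = b.opp := by
      constructor <;> (rintro rfl; exact (Idx.opp_opp _).symm)
    exact if_congr this rfl rfl
  exact LinearMap.congr_fun₂ this v w

/-- Endomorphisms of `V` that kill all but finitely many of the basis vectors. -/
def finitary (T : SpinType) (ι : Type) : LieSubalgebra ℂ (Module.End ℂ (NatMod T ι)) where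
  carrier := {X | {a : Idx T ι | X (Finsupp.single a 1) ≠ 0}.Finite}
  zero_mem' := by simp
  add_mem' {X Y} hX hY := by
    refine (hX.union hY).subset fun a ha => ?_
    by_contra h
    simp only [Set.mem_union, Set.mem_ofPred_eq, not_or, not_not] at h
    exact ha (by simp [h.1, h.2])
  smul_mem' c X hX := by
    refine hX.subset fun a ha h => ha ?_
    simp [h]
  lie_mem' {X Y} hX hY := by
    refine (hX.union hY).subset fun a ha => ?_
    by_contra h
    simp only [Set.mem_union, Set.mem_ofPred_eq, not_or, not_not] at h
    exact ha (by simp [LieRing.of_associative_ring_bracket, h.1, h.2])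

/-- The orthogonal Lie algebra of `V`. -/
def o (T : SpinType) (ι : Type) : LieSubalgebra ℂ (Module.End ℂ (NatMod T ι)) :=
  skewAdjointLieSubalgebra (form T ι) ⊓ finitary T ι

theorem o_skew (X : o T ι) (v w : NatMod T ι) :
    form T ι (X.1 v) w = - form T ι v (X.1 w) := by
  have h2 : (form T ι).IsSkewAdjoint X.1 :=
    (LinearMap.mem_skewAdjointSubmodule _).1 X.2.1
  simpa using h2 v w

theorem o_fin (X : o T ι) : {a : Idx T ι | X.1 (Finsupp.single a 1) ≠ 0}.Finite := X.2.2


/-- The underlying vector space of the spinor modules: the basis vector indexed by `F` stands for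
the subset `A ∆ F`, so the basis runs over all subsets that differ from `A` by finitely many
elements. -/
def Fock (_T : SpinType) {ι : Type} (_A : Set ι) : Type := Finset ι →₀ ℂ

variable (T) (A : Set ι)

instance : AddCommGroup (Fock T A) := inferInstanceAs (AddCommGroup (Finset ι →₀ ℂ))
instance : Module ℂ (Fock T A) := inferInstanceAs (Module ℂ (Finset ι →₀ ℂ))

/-- The basis vector of weight `ω_{A ∆ F}`. -/
def Fock.vec (F : Finset ι) : Fock T A := (Finsupp.single F 1 : Finset ι →₀ ℂ)

variable {T A}

theorem Fock.hom_ext {f g : Module.End ℂ (Fock T A)}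
    (h : ∀ F, f (Fock.vec T A F) = g (Fock.vec T A F)) : f = g :=
  Finsupp.lhom_ext' (M := ℂ) fun F => LinearMap.ext_ring (h F)

variable (T A)

/-- Linear extension of a prescription on basis vectors. -/
def Fock.lift (f : Finset ι → Fock T A) : Module.End ℂ (Fock T A) :=
  (Finsupp.linearCombination ℂ f : (Finset ι →₀ ℂ) →ₗ[ℂ] Fock T A)

variable {T A}

theorem Fock.lift_vec (f : Finset ι → Fock T A) (F : Finset ι) :
    Fock.lift T A f (Fock.vec T A F) = f F := by
  unfold Fock.lift Fock.vec
  erw [Finsupp.linearCombination_single]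
  simp

variable [LinearOrder ι]

/-- The sign occurring when the membership of `i` is changed. -/
def sgn (F : Finset ι) (i : ι) : ℂ := (-1) ^ (F.filter (· < i)).card

/-- Remove `i` from `F` if it is there, add it otherwise. -/
def toggle (F : Finset ι) (i : ι) : Finset ι := symmDiff F {i}

variable (T A)

open Classical in
/-- Generators of the Clifford algebra of `V`. On the vector indexed by a set `A'`, `e_i` adds `i`
to `A'`, `e_{-i}` removes `i` from `A'` (up to sign, and with value `0` where this is impossible),
and `e_0` is `±1/√2`. -/
def gamma : Idx T ι → Module.End ℂ (Fock T A)
  | .pos i => Fock.lift T A fun F =>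
      if i ∈ symmDiff A (F : Set ι) then 0 else sgn F i • Fock.vec T A (toggle F i)
  | .neg i => Fock.lift T A fun F =>
      if i ∈ symmDiff A (F : Set ι) then sgn F i • Fock.vec T A (toggle F i) else 0
  | .zero _ => Fock.lift T A fun F =>
      (((Real.sqrt 2)⁻¹ : ℝ) : ℂ) • (-1 : ℂ) ^ F.card • Fock.vec T A F

/-- The linear extension of `gamma` to `V`. -/
def psi : NatMod T ι →ₗ[ℂ] Module.End ℂ (Fock T A) := Finsupp.linearCombination ℂ (gamma T A)

variable {T A}

theorem toggle_toggle (F : Finset ι) (i : ι) : toggle (toggle F i) i = F := by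
  simp [toggle]

theorem toggle_comm (F : Finset ι) (i j : ι) :
    toggle (toggle F i) j = toggle (toggle F j) i := by
  simp [toggle, symmDiff_assoc, symmDiff_comm ({i} : Finset ι)]

theorem mem_toggle (F : Finset ι) (i j : ι) :
    j ∈ symmDiff A (toggle F i : Set ι) ↔
      ((j ∈ symmDiff A (F : Set ι)) ↔ j ≠ i) := by
  simp only [toggle, Set.mem_symmDiff, Finset.mem_coe, Finset.mem_symmDiff, Finset.mem_singleton]
  tauto

theorem neg_one_pow_card_symmDiff (F G : Finset ι) :
    (-1 : ℂ) ^ (symmDiff F G).card = (-1) ^ F.card * (-1) ^ G.card := by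
  have h1 := Finset.card_sdiff_add_card_inter F G
  have h2 := Finset.card_sdiff_add_card_inter G F
  have h3 : (symmDiff F G).card = (F \ G).card + (G \ F).card := by
    rw [symmDiff_def, Finset.sup_eq_union, Finset.card_union_of_disjoint]
    exact disjoint_sdiff_sdiff
  rw [Finset.inter_comm] at h2
  rw [h3, ← h1, ← h2, pow_add, pow_add, pow_add]
  have : ((-1 : ℂ) ^ (F ∩ G).card) * (-1) ^ (F ∩ G).card = 1 := by
    rw [← mul_pow]; simp
  linear_combination (-(-1 : ℂ) ^ (F \ G).card * (-1) ^ (G \ F).card) * this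

theorem sgn_toggle (F : Finset ι) (i j : ι) :
    sgn (toggle F i) j = (if i < j then -1 else 1) * sgn F j := by
  have h : (toggle F i).filter (· < j) =
      symmDiff (F.filter (· < j)) (({i} : Finset ι).filter (· < j)) := by
    ext k
    simp only [toggle, Finset.mem_filter, Finset.mem_symmDiff]
    tauto
  unfold sgn
  rw [h, neg_one_pow_card_symmDiff, mul_comm]
  congr 1
  by_cases hij : i < j <;> simp [Finset.filter_singleton, hij]

theorem card_toggle (F : Finset ι) (i : ι) :
    (-1 : ℂ) ^ (toggle F i).card = - (-1) ^ F.card := by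
  rw [toggle, neg_one_pow_card_symmDiff]; simp

theorem sgn_mul_self (F : Finset ι) (i : ι) : sgn F i * sgn F i = 1 := by
  unfold sgn; rw [← mul_pow]; simp

theorem gamma_clifford (a b : Idx T ι) :
    gamma T A a * gamma T A b + gamma T A b * gamma T A a =
      (Finsupp.single b (1 : ℂ) : NatMod T ι) a.opp • (1 : Module.End ℂ (Fock T A)) := by
  classical
  have s2 : (((Real.sqrt 2)⁻¹ : ℝ) : ℂ) * (((Real.sqrt 2)⁻¹ : ℝ) : ℂ) = 1 / 2 := by
    rw [← Complex.ofReal_mul, ← mul_inv, Real.mul_self_sqrt (by norm_num)]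
    norm_num
  apply Fock.hom_ext
  intro F
  have c2 : (-1 : ℂ) ^ F.card * (-1) ^ F.card = 1 := by rw [← mul_pow]; simp
  cases a <;> cases b <;>
    simp only [gamma, LinearMap.add_apply, Module.End.mul_apply, Fock.lift_vec, Idx.opp,
      Finsupp.single_apply, LinearMap.smul_apply, Module.End.one_apply]
  case pos.pos i j =>
    rcases lt_trichotomy i j with h | h | h
    · have hne := h.ne
      by_cases hi : i ∈ symmDiff A (F : Set ι) <;> by_cases hj : j ∈ symmDiff A (F : Set ι) <;>
      simp [hi, hj, mem_toggle, sgn_toggle, h, hne, hne.symm, h.not_gt, Fock.lift_vec, toggle_comm F j i,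
        smul_smul, mul_comm]
    · subst h
      by_cases hi : i ∈ symmDiff A (F : Set ι) <;>
      simp [hi, mem_toggle, sgn_toggle, Fock.lift_vec, toggle_toggle, smul_smul, sgn_mul_self]
    · have hne := h.ne
      by_cases hi : i ∈ symmDiff A (F : Set ι) <;> by_cases hj : j ∈ symmDiff A (F : Set ι) <;>
      simp [hi, hj, mem_toggle, sgn_toggle, h, hne, hne.symm, h.not_gt, Fock.lift_vec, toggle_comm F j i,
        smul_smul, mul_comm]
  case pos.neg i j =>
    rcases lt_trichotomy i j with h | h | h
    · have hne := h.ne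
      by_cases hi : i ∈ symmDiff A (F : Set ι) <;> by_cases hj : j ∈ symmDiff A (F : Set ι) <;>
      simp [hi, hj, mem_toggle, sgn_toggle, h, hne, hne.symm, h.not_gt, Fock.lift_vec, toggle_comm F j i,
        smul_smul, mul_comm]
    · subst h
      by_cases hi : i ∈ symmDiff A (F : Set ι) <;>
      simp [hi, mem_toggle, sgn_toggle, Fock.lift_vec, toggle_toggle, smul_smul, sgn_mul_self]
    · have hne := h.ne
      by_cases hi : i ∈ symmDiff A (F : Set ι) <;> by_cases hj : j ∈ symmDiff A (F : Set ι) <;>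
      simp [hi, hj, mem_toggle, sgn_toggle, h, hne, hne.symm, h.not_gt, Fock.lift_vec, toggle_comm F j i,
        smul_smul, mul_comm]
  case neg.pos i j =>
    rcases lt_trichotomy i j with h | h | h
    · have hne := h.ne
      by_cases hi : i ∈ symmDiff A (F : Set ι) <;> by_cases hj : j ∈ symmDiff A (F : Set ι) <;>
      simp [hi, hj, mem_toggle, sgn_toggle, h, hne, hne.symm, h.not_gt, Fock.lift_vec, toggle_comm F j i,
        smul_smul, mul_comm]
    · subst h
      by_cases hi : i ∈ symmDiff A (F : Set ι) <;>
      simp [hi, mem_toggle, sgn_toggle, Fock.lift_vec, toggle_toggle, smul_smul, sgn_mul_self]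
    · have hne := h.ne
      by_cases hi : i ∈ symmDiff A (F : Set ι) <;> by_cases hj : j ∈ symmDiff A (F : Set ι) <;>
      simp [hi, hj, mem_toggle, sgn_toggle, h, hne, hne.symm, h.not_gt, Fock.lift_vec, toggle_comm F j i,
        smul_smul, mul_comm]
  case neg.neg i j =>
    rcases lt_trichotomy i j with h | h | h
    · have hne := h.ne
      by_cases hi : i ∈ symmDiff A (F : Set ι) <;> by_cases hj : j ∈ symmDiff A (F : Set ι) <;>
      simp [hi, hj, mem_toggle, sgn_toggle, h, hne, hne.symm, h.not_gt, Fock.lift_vec, toggle_comm F j i,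
        smul_smul, mul_comm]
    · subst h
      by_cases hi : i ∈ symmDiff A (F : Set ι) <;>
      simp [hi, mem_toggle, sgn_toggle, Fock.lift_vec, toggle_toggle, smul_smul, sgn_mul_self]
    · have hne := h.ne
      by_cases hi : i ∈ symmDiff A (F : Set ι) <;> by_cases hj : j ∈ symmDiff A (F : Set ι) <;>
      simp [hi, hj, mem_toggle, sgn_toggle, h, hne, hne.symm, h.not_gt, Fock.lift_vec, toggle_comm F j i,
        smul_smul, mul_comm]
  case pos.zero i h =>
    by_cases hi : i ∈ symmDiff A (F : Set ι) <;>
    simp [hi, Fock.lift_vec, smul_smul, card_toggle, mul_comm, mul_left_comm]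
  case neg.zero i h =>
    by_cases hi : i ∈ symmDiff A (F : Set ι) <;>
    simp [hi, Fock.lift_vec, smul_smul, card_toggle, mul_comm, mul_left_comm]
  case zero.pos h i =>
    by_cases hi : i ∈ symmDiff A (F : Set ι) <;>
    simp [hi, Fock.lift_vec, smul_smul, card_toggle, mul_comm, mul_left_comm]
  case zero.neg h i =>
    by_cases hi : i ∈ symmDiff A (F : Set ι) <;>
    simp [hi, Fock.lift_vec, smul_smul, card_toggle, mul_comm, mul_left_comm]
  case zero.zero h _ =>
    simp only [map_smul, Fock.lift_vec, smul_smul, ← add_smul, if_true]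
    congr 1
    linear_combination 2 * (-1 : ℂ) ^ F.card * (-1) ^ F.card * s2 + c2

theorem psi_single (a : Idx T ι) : psi T A (Finsupp.single a 1) = gamma T A a := by
  simp [psi]

theorem psi_clifford (v w : NatMod T ι) :
    psi T A v * psi T A w + psi T A w * psi T A v =
      form T ι v w • (1 : Module.End ℂ (Fock T A)) := by
  have : (LinearMap.mul ℂ (Module.End ℂ (Fock T A))).compl₁₂ (psi T A) (psi T A) +
      ((LinearMap.mul ℂ (Module.End ℂ (Fock T A))).compl₁₂ (psi T A) (psi T A)).flip =
      (form T ι).compr₂ (LinearMap.toSpanSingleton ℂ _ (1 : Module.End ℂ (Fock T A))) := by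
    ext a b : 4
    simpa [psi_single, form_single] using gamma_clifford (A := A) a b
  simpa using LinearMap.congr_fun₂ this v w

variable (T A)

/-- The action on the Fock space: `X ↦ ½ ∑_b ψ(X e_b) ψ(e_{-b})`. The sum is finite. -/
def rho (X : o T ι) : Module.End ℂ (Fock T A) :=
  (1 / 2 : ℂ) • ∑ᶠ b : Idx T ι,
    psi T A (X.1 (Finsupp.single b 1)) * psi T A (Finsupp.single b.opp 1)

variable {T A}

theorem rho_eq (X : o T ι) (s : Finset (Idx T ι))
    (hs : ∀ b, X.1 (Finsupp.single b 1) ≠ 0 → b ∈ s) :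
    rho T A X = (1 / 2 : ℂ) • ∑ b ∈ s,
      psi T A (X.1 (Finsupp.single b 1)) * psi T A (Finsupp.single b.opp 1) := by
  unfold rho
  rw [finsum_eq_sum_of_support_subset]
  intro b hb
  refine hs b fun h => hb ?_
  simp [h]

/-- A finite set of indices outside of which `X` vanishes. -/
theorem exists_bound (X : o T ι) : ∃ s : Finset (Idx T ι),
    ∀ b, X.1 (Finsupp.single b 1) ≠ 0 → b ∈ s :=
  ⟨(o_fin X).toFinset, fun b hb => by simpa using hb⟩

theorem rho_add (X Y : o T ι) : rho T A (X + Y) = rho T A X + rho T A Y := by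
  classical
  obtain ⟨s, hs⟩ := exists_bound X
  obtain ⟨t, ht⟩ := exists_bound Y
  obtain ⟨u, hu⟩ := exists_bound (X + Y)
  rw [rho_eq X (s ∪ t ∪ u) (fun b hb => by simp [hs b hb]),
    rho_eq Y (s ∪ t ∪ u) (fun b hb => by simp [ht b hb]),
    rho_eq (X + Y) (s ∪ t ∪ u) (fun b hb => by simp [hu b hb]), ← smul_add,
    ← Finset.sum_add_distrib]
  simp [add_mul]

theorem rho_smul (c : ℂ) (X : o T ι) : rho T A (c • X) = c • rho T A X := by
  classical
  obtain ⟨s, hs⟩ := exists_bound X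
  rw [rho_eq X s hs, rho_eq (c • X) s, smul_comm]
  · simp [Finset.smul_sum]
  · intro b hb
    refine hs b fun h => hb ?_
    simp [h]

/-- `X w = ∑_b (e_{-b}, w) X e_b`. -/
theorem sum_form (X : o T ι) (s : Finset (Idx T ι))
    (hs : ∀ b, X.1 (Finsupp.single b 1) ≠ 0 → b ∈ s) (w : NatMod T ι) :
    ∑ b ∈ s, form T ι (Finsupp.single b.opp 1) w • X.1 (Finsupp.single b 1) = X.1 w := by
  classical
  conv_rhs => rw [← Finsupp.sum_single w, Finsupp.sum, map_sum]
  have e : ∀ b, X.1 (Finsupp.single b (w b)) = w b • X.1 (Finsupp.single b 1) := fun b => by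
    rw [← map_smul, Finsupp.smul_single_one]
  simp only [form_single, Idx.opp_opp, e]
  have h1 := Finset.sum_subset (f := fun b => w b • X.1 (Finsupp.single b 1))
    (Finset.subset_union_left (s₁ := s) (s₂ := w.support)) fun b _ hb => by
      have : X.1 (Finsupp.single b 1) = 0 := by
        by_contra h
        exact hb (hs b h)
      simp [this]
  have h2 := Finset.sum_subset (f := fun b => w b • X.1 (Finsupp.single b 1))
    (Finset.subset_union_right (s₁ := s) (s₂ := w.support)) fun b _ hb => by
      simp [Finsupp.notMem_support_iff.1 hb]
  exact h1.trans h2.symm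

/-- `∑_b (w, X e_b) e_{-b} = - X w`. -/
theorem sum_form' (X : o T ι) (s : Finset (Idx T ι))
    (hs : ∀ b, X.1 (Finsupp.single b 1) ≠ 0 → b ∈ s) (w : NatMod T ι) :
    ∑ b ∈ s, form T ι w (X.1 (Finsupp.single b 1)) • Finsupp.single b.opp (1 : ℂ) = - X.1 w := by
  classical
  ext a
  have e : ∀ b, form T ι w (X.1 (Finsupp.single b 1)) = - (X.1 w) b.opp := fun b => by
    rw [form_comm, o_skew, form_single]
  simp only [e, Finsupp.coe_finsetSum, Finset.sum_apply, Finsupp.smul_apply, Finsupp.neg_apply,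
    Finsupp.single_apply, smul_eq_mul, mul_ite, mul_one, mul_zero]
  have e2 : ∀ b : Idx T ι, b.opp = a ↔ b = a.opp := fun b => by
    constructor <;> (rintro rfl; simp [Idx.opp_opp])
  simp only [e2, Finset.sum_ite_eq', Idx.opp_opp]
  split_ifs with h
  · rfl
  · have h0 : X.1 (Finsupp.single a.opp 1) = 0 := by
      by_contra h'
      exact h (hs _ h')
    have := e a.opp
    rw [h0, Idx.opp_opp] at this
    simpa using this

/-- `[ρ(X), ψ(w)] = ψ(X w)`. -/
theorem rho_psi (X : o T ι) (w : NatMod T ι) :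
    rho T A X * psi T A w - psi T A w * rho T A X = psi T A (X.1 w) := by
  obtain ⟨s, hs⟩ := exists_bound X
  have key : ∀ v u : NatMod T ι, psi T A v * psi T A u * psi T A w - psi T A w * (psi T A v * psi T A u)
      = form T ι u w • psi T A v - form T ι w v • psi T A u := fun v u => by
    have h1 := psi_clifford (A := A) u w
    have h2 := psi_clifford (A := A) w v
    have h3 : psi T A v * (psi T A u * psi T A w + psi T A w * psi T A u)
        = form T ι u w • psi T A v := by rw [h1]; simp
    have h4 : (psi T A w * psi T A v + psi T A v * psi T A w) * psi T A u
        = form T ι w v • psi T A u := by rw [h2]; simp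
    rw [← h3, ← h4]
    noncomm_ring
  rw [rho_eq X s hs, smul_mul_assoc, mul_smul_comm, ← smul_sub, Finset.sum_mul, Finset.mul_sum,
    ← Finset.sum_sub_distrib]
  simp only [key]
  rw [Finset.sum_sub_distrib]
  have e1 := congrArg (psi T A) (sum_form X s hs w)
  have e2 := congrArg (psi T A) (sum_form' X s hs w)
  rw [map_sum] at e1 e2
  simp only [map_smul, map_neg] at e1 e2
  rw [e1, e2, sub_neg_eq_add,
    ← two_smul ℂ, smul_smul]
  norm_num

theorem rho_lie (X Y : o T ι) :
    rho T A ⁅X, Y⁆ = rho T A X * rho T A Y - rho T A Y * rho T A X := by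
  classical
  obtain ⟨s, hs⟩ := exists_bound X
  obtain ⟨t, ht⟩ := exists_bound Y
  obtain ⟨u, hu⟩ := exists_bound ⁅X, Y⁆
  set p : Finset (Idx T ι) := s ∪ t ∪ u with hp
  have hX : ∀ b, X.1 (Finsupp.single b 1) ≠ 0 → b ∈ p := fun b hb => by simp [hp, hs b hb]
  have hY : ∀ b, Y.1 (Finsupp.single b 1) ≠ 0 → b ∈ p := fun b hb => by simp [hp, ht b hb]
  have hXY : ∀ b, ⁅X, Y⁆.1 (Finsupp.single b 1) ≠ 0 → b ∈ p := fun b hb => by simp [hp, hu b hb]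
  have key : ∀ v w : NatMod T ι, rho T A X * (psi T A v * psi T A w) -
      psi T A v * psi T A w * rho T A X =
      psi T A (X.1 v) * psi T A w + psi T A v * psi T A (X.1 w) := fun v w => by
    rw [← rho_psi X v, ← rho_psi X w]
    noncomm_ring
  have main : ∑ b ∈ p, psi T A (Y.1 (Finsupp.single b 1)) * psi T A (X.1 (Finsupp.single b.opp 1))
      = - ∑ b ∈ p, psi T A (Y.1 (X.1 (Finsupp.single b 1))) * psi T A (Finsupp.single b.opp 1) := by
    have h1 : ∀ b : Idx T ι, X.1 (Finsupp.single b.opp 1) = - ∑ c ∈ p,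
        form T ι (Finsupp.single b.opp 1) (X.1 (Finsupp.single c 1)) •
          Finsupp.single c.opp (1 : ℂ) := fun b => by rw [sum_form' X p hX, neg_neg]
    have h2 : ∀ c, Y.1 (X.1 (Finsupp.single c 1)) = ∑ b ∈ p,
        form T ι (Finsupp.single b.opp 1) (X.1 (Finsupp.single c 1)) • Y.1 (Finsupp.single b 1) :=
      fun c => (sum_form Y p hY _).symm
    simp only [h1, h2, map_neg, map_sum, map_smul, mul_neg, Finset.sum_neg_distrib,
      Finset.mul_sum, Finset.sum_mul, mul_smul_comm, smul_mul_assoc]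
    rw [Finset.sum_comm]
  rw [rho_eq Y p hY, rho_eq ⁅X, Y⁆ p hXY, smul_mul_assoc, mul_smul_comm, ← smul_sub,
    Finset.mul_sum, Finset.sum_mul, ← Finset.sum_sub_distrib]
  simp only [key]
  rw [Finset.sum_add_distrib, main, ← sub_eq_add_neg, ← Finset.sum_sub_distrib]
  congr 1
  refine Finset.sum_congr rfl fun b _ => ?_
  rw [← sub_mul, ← map_sub]
  rfl

instance : LieRingModule (o T ι) (Fock T A) where
  bracket X m := rho T A X m
  add_lie X Y m := by
    rw [rho_add]; rfl
  lie_add X m n := map_add (rho T A X) m n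
  leibniz_lie X Y m := by
    change rho T A X (rho T A Y m) = rho T A ⁅X, Y⁆ m + rho T A Y (rho T A X m)
    rw [rho_lie]
    simp

instance : LieModule ℂ (o T ι) (Fock T A) where
  smul_lie c X m := by
    change rho T A (c • X) m = c • rho T A X m
    rw [rho_smul]; rfl
  lie_smul c X m := map_smul (rho T A X) c m

theorem lie_def (X : o T ι) (m : Fock T A) : ⁅X, m⁆ = rho T A X m := rfl

variable (T A)

/-- The coefficient of a vector at the basis vector `Fock.vec T A F`. -/
def Fock.coeff {T : SpinType} {A : Set ι} (m : Fock T A) (F : Finset ι) : ℂ :=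
  (show Finset ι →₀ ℂ from m) F

/-- The parity operator. -/
def parity : Module.End ℂ (Fock T A) := Fock.lift T A fun F => (-1 : ℂ) ^ F.card • Fock.vec T A F

variable {T A}

theorem coeff_parity (m : Fock T A) (F : Finset ι) :
    (parity T A m).coeff F = (-1) ^ F.card * m.coeff F := by
  classical
  let c : Fock T A →ₗ[ℂ] ℂ := (Finsupp.lapply F : (Finset ι →₀ ℂ) →ₗ[ℂ] ℂ)
  have h : c ∘ₗ parity T A = (-1 : ℂ) ^ F.card • c := by
    refine Finsupp.lhom_ext' (M := ℂ) fun G => LinearMap.ext_ring ?_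
    change c (parity T A (Fock.vec T A G)) = (-1 : ℂ) ^ F.card • c (Fock.vec T A G)
    unfold parity
    rw [Fock.lift_vec, map_smul]
    change _ • (Finsupp.single G (1 : ℂ)) F = _ • (Finsupp.single G (1 : ℂ)) F
    by_cases hG : G = F
    · rw [hG]
    · simp [Finsupp.single_apply, hG]
  exact LinearMap.congr_fun h m

theorem parity_gamma (hT : T = SpinType.D) (a : Idx T ι) :
    parity T A * gamma T A a = - (gamma T A a * parity T A) := by
  classical
  apply Fock.hom_ext
  intro F
  cases a with
  | zero h => exact absurd (h.symm.trans hT) (by simp)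
  | pos i =>
    by_cases hi : i ∈ symmDiff A (F : Set ι) <;>
    simp [parity, gamma, Fock.lift_vec, hi, card_toggle, smul_smul, mul_comm]
  | neg i =>
    by_cases hi : i ∈ symmDiff A (F : Set ι) <;>
    simp [parity, gamma, Fock.lift_vec, hi, card_toggle, smul_smul, mul_comm]

theorem parity_psi (hT : T = SpinType.D) (v : NatMod T ι) :
    parity T A * psi T A v = - (psi T A v * parity T A) := by
  have : (LinearMap.mulLeft ℂ (parity T A)) ∘ₗ psi T A =
      - (LinearMap.mulRight ℂ (parity T A)) ∘ₗ psi T A := by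
    ext a : 2
    simpa [psi_single] using parity_gamma (A := A) hT a
  simpa using LinearMap.congr_fun this v

theorem parity_rho (hT : T = SpinType.D) (X : o T ι) :
    parity T A * rho T A X = rho T A X * parity T A := by
  obtain ⟨s, hs⟩ := exists_bound X
  rw [rho_eq X s hs, smul_mul_assoc, mul_smul_comm, Finset.mul_sum, Finset.sum_mul]
  congr 1
  refine Finset.sum_congr rfl fun b _ => ?_
  rw [← mul_assoc, parity_psi hT, neg_mul, mul_assoc, parity_psi hT, mul_neg, neg_neg, mul_assoc]

theorem even_iff_parity (m : Fock T A) :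
    (∀ F, m.coeff F ≠ 0 → Even F.card) ↔ parity T A m = m := by
  constructor
  · intro h
    refine Finsupp.ext (M := ℂ) fun F => ?_
    change (parity T A m).coeff F = m.coeff F
    rw [coeff_parity]
    by_cases h0 : m.coeff F = 0
    · simp [h0]
    · simp [(h F h0).neg_one_pow]
  · intro h F hF
    have := coeff_parity m F
    rw [h] at this
    by_contra hodd
    rw [Nat.not_even_iff_odd] at hodd
    rw [hodd.neg_one_pow] at this
    apply hF
    linear_combination this / 2

variable (T A)

/-- The spinor module with support `{ω_{A'}}`, where `A'` differs from `A` by finitely many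
(type `B`), respectively by an even number (type `D`), of elements. Here `ω_{A'}` has the
coordinates `1/2` at the elements of `A'` and `-1/2` elsewhere. For index set `ℤ_{>0}` this is the
union of the finite-dimensional spinor modules of `o(2n+1)`, respectively `o(2n)`, spanned by the
vectors with `F ⊆ {1, …, n}`; the `n`-th inclusion sends a vector of weight `λ` to one of weight
`(λ, 1/2)` if `n ∈ A` and `(λ, -1/2)` if `n ∉ A`, i.e. this is their direct limit. In type `D` the
`n`-th module is the half-spinor module containing the weight `ω_{A ∩ {1, …, n}}`. -/
def Spinor : LieSubmodule ℂ (o T ι) (Fock T A) where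
  carrier := {m | T = SpinType.D → ∀ F, m.coeff F ≠ 0 → Even F.card}
  zero_mem' := fun _ F h => absurd rfl h
  add_mem' {m n} hm hn hT := by
    have hm' := (even_iff_parity m).1 (hm hT)
    have hn' := (even_iff_parity n).1 (hn hT)
    exact (even_iff_parity _).2 (by rw [map_add, hm', hn'])
  smul_mem' c m hm hT := by
    have hm' := (even_iff_parity m).1 (hm hT)
    exact (even_iff_parity _).2 (by rw [map_smul, hm'])
  lie_mem {X m} hm hT := by
    have hm' := (even_iff_parity m).1 (hm hT)
    refine (even_iff_parity _).2 ?_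
    have := LinearMap.congr_fun (parity_rho (A := A) hT X) m
    rw [Module.End.mul_apply, Module.End.mul_apply, hm'] at this
    exact this

/-- The spinor module of highest weight `(1/2, …, 1/2)`: this is `S_n` in type `B` and `S_n^+` in
type `D`. -/
abbrev spinPlus (T : SpinType) (n : ℕ) : LieSubmodule ℂ (o T (Fin n)) (Fock T (Set.univ : Set (Fin n))) :=
  Spinor T (Set.univ : Set (Fin n))

/-- The spinor module of highest weight `(1/2, …, 1/2, -1/2)`: this is `S_n^-` in type `D`. -/
abbrev spinMinus (T : SpinType) (n : ℕ) :
    LieSubmodule ℂ (o T (Fin n)) (Fock T {i : Fin n | (i : ℕ) + 1 ≠ n}) :=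
  Spinor T {i : Fin n | (i : ℕ) + 1 ≠ n}

end OInf

/-! Relabelling of indices. -/

namespace OInf

variable {T : SpinType} {ι κ : Type}

/-- Relabelling of indices. -/
def Idx.map (e : κ → ι) : Idx T κ → Idx T ι
  | .pos i => .pos (e i)
  | .neg i => .neg (e i)
  | .zero h => .zero h

theorem Idx.map_injective (e : κ ↪ ι) : Function.Injective (Idx.map (T := T) e) := by
  intro a b h
  cases a <;> cases b <;> simp_all [Idx.map]

theorem Idx.map_opp (e : κ → ι) (a : Idx T κ) : a.opp.map e = (a.map e).opp := by
  cases a <;> rfl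

/-- The embedding of natural modules `e_a ↦ e_{e(a)}`. -/
def ext (T : SpinType) (e : κ ↪ ι) : NatMod T κ →ₗ[ℂ] NatMod T ι :=
  Finsupp.lmapDomain ℂ ℂ (Idx.map e)

/-- The projection of natural modules left inverse to `ext`. -/
def res (T : SpinType) (e : κ ↪ ι) : NatMod T ι →ₗ[ℂ] NatMod T κ :=
  Finsupp.lcomapDomain (Idx.map e) (Idx.map_injective e)

theorem ext_single (e : κ ↪ ι) (a : Idx T κ) (c : ℂ) :
    ext T e (Finsupp.single a c) = Finsupp.single (a.map e) c := by
  simp [ext]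

theorem res_apply (e : κ ↪ ι) (v : NatMod T ι) (a : Idx T κ) : res T e v a = v (a.map e) := rfl

theorem res_ext (e : κ ↪ ι) (v : NatMod T κ) : res T e (ext T e v) = v := by
  ext a
  rw [res_apply]
  exact Finsupp.mapDomain_apply (Idx.map_injective e) v a

theorem form_ext (e : κ ↪ ι) (v : NatMod T κ) (w : NatMod T ι) :
    form T ι (ext T e v) w = form T κ v (res T e w) := by
  have : (form T ι) ∘ₗ (ext T e) = (form T κ).compl₂ (res T e) := by
    refine Finsupp.lhom_ext' fun a => LinearMap.ext_ring (LinearMap.ext fun w => ?_)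
    simp [ext_single, form_single, res_apply, Idx.map_opp]
  exact LinearMap.congr_fun₂ this v w

/-- The embedding `o(κ) → o(ι)` of orthogonal Lie algebras induced by an embedding of indices. -/
def o.map (T : SpinType) (e : κ ↪ ι) : o T κ →ₗ⁅ℂ⁆ o T ι where
  toFun X := ⟨ext T e ∘ₗ X.1 ∘ₗ res T e, by
    constructor
    · refine (LinearMap.mem_skewAdjointSubmodule _).2 fun v w => ?_
      simp only [LinearMap.comp_apply, Pi.neg_apply, map_neg]
      rw [form_ext, o_skew, form_comm (ι := ι), form_ext, form_comm]
    · refine ((o_fin X).image (Idx.map e)).subset fun a ha => ?_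
      by_contra h
      apply ha
      have : X.1 (res T e (Finsupp.single a 1)) = 0 := by
        by_cases hr : ∃ b, Idx.map e b = a
        · obtain ⟨b, rfl⟩ := hr
          rw [← ext_single, res_ext]
          by_contra hb
          exact h ⟨b, hb, rfl⟩
        · have : res T e (Finsupp.single a 1) = 0 := by
            classical
            ext b
            rw [res_apply, Finsupp.single_apply, if_neg fun h => hr ⟨b, h.symm⟩]
            rfl
          rw [this, map_zero]
      simp [this]⟩
  map_add' X Y := by
    apply Subtype.ext
    refine LinearMap.ext fun v => ?_
    simp
  map_smul' c X := by
    apply Subtype.ext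
    refine LinearMap.ext fun v => ?_
    simp
  map_lie' {X Y} := by
    apply Subtype.ext
    refine LinearMap.ext fun v => ?_
    simp [LieRing.of_associative_ring_bracket, res_ext]

end OInf

/-! Roots, parabolic subalgebras and aligned modules. -/

namespace OInf

variable (T : SpinType)

/-- `o(∞)`, with the Cartan subalgebra of type `B` or `D`. -/
abbrev g : LieSubalgebra ℂ (Module.End ℂ (NatMod T ℕ+)) := o T ℕ+

/-- The splitting Cartan subalgebra `h`: the elements of `o(∞)` diagonal in the basis `e_a`. -/
def cartan : LieSubalgebra ℂ (g T) where
  carrier := {H | ∀ a, ∃ c : ℂ, H.1 (Finsupp.single a 1) = Finsupp.single a c}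
  zero_mem' a := ⟨0, by simp⟩
  add_mem' {H K} hH hK a := by
    obtain ⟨c, hc⟩ := hH a
    obtain ⟨d, hd⟩ := hK a
    exact ⟨c + d, by simp [hc, hd]⟩
  smul_mem' c H hH a := by
    obtain ⟨d, hd⟩ := hH a
    exact ⟨c * d, by simp [hd]⟩
  lie_mem' {H K} hH hK a := by
    obtain ⟨c, hc⟩ := hH a
    obtain ⟨d, hd⟩ := hK a
    refine ⟨0, ?_⟩
    have e : ∀ x : ℂ, (Finsupp.single a x : NatMod T ℕ+) = x • Finsupp.single a 1 := by simp
    have h1 : H.1 (K.1 (Finsupp.single a 1)) = K.1 (H.1 (Finsupp.single a 1)) := by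
      rw [hc, hd, e c, e d, map_smul, map_smul, hc, hd, e c, e d, smul_smul, smul_smul, mul_comm]
    simp [LieRing.of_associative_ring_bracket, h1]

variable {T}

/-- The weight of `e_a`: `ε_i` for `a = i`, `-ε_i` for `a = -i`, and `0` for `a = 0`. -/
def eps (a : Idx T ℕ+) : Module.Dual ℂ (cartan T) where
  toFun H := H.1.1 (Finsupp.single a 1) a
  map_add' H K := by simp
  map_smul' c H := by simp

/-- The root space `g_α`. -/
def rootSpace (α : Module.Dual ℂ (cartan T)) : Submodule ℂ (g T) where
  carrier := {x | ∀ H : cartan T, ⁅(H : g T), x⁆ = α H • x}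
  zero_mem' H := by simp
  add_mem' hx hy H := by simp only [lie_add, smul_add, hx H, hy H]
  smul_mem' c x hx H := by simp only [lie_smul, hx H, smul_comm c]

variable (T)

/-- The root system `Δ`. -/
def roots : Set (Module.Dual ℂ (cartan T)) := {α | α ≠ 0 ∧ rootSpace α ≠ ⊥}

/-- The integer `i`, `-i` or `0` labelling a basis vector of the natural module. -/
def Idx.toInt {T : SpinType} : Idx T ℕ+ → ℤ
  | .pos i => (i : ℕ)
  | .neg i => -(i : ℕ)
  | .zero _ => 0

/-- The set `[i]` of a strict partial order on `ℤ`. -/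
def cls (r : ℤ → ℤ → Prop) (i : ℤ) : Set ℤ := {i} ∪ {j | ¬ r i j ∧ ¬ r j i}

/-- Admissibility of a strict partial order. -/
def Admissible (r : ℤ → ℤ → Prop) : Prop :=
  ∀ i j, cls r i ≠ cls r j → Disjoint (cls r i) (cls r j)

/-- Multiplication by `-1` reverses the order. -/
def Z2Linear (r : ℤ → ℤ → Prop) : Prop := ∀ i j, r i j ↔ r (-j) (-i)

variable (r : ℤ → ℤ → Prop)

/-- `P(≺)^+`, the set of roots `α ≻ 0`, where `ε_a - ε_b ≻ 0` if `a ≺ b`. -/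
def rootsPos : Set (Module.Dual ℂ (cartan T)) :=
  {α | α ∈ roots T ∧ ∃ a b : Idx T ℕ+, α = eps a - eps b ∧ r a.toInt b.toInt}

/-- `P(≺)^0`, the set of roots not comparable with `0`. -/
def rootsZero : Set (Module.Dual ℂ (cartan T)) :=
  {α | α ∈ roots T ∧ α ∉ rootsPos T r ∧ -α ∉ rootsPos T r}

/-- The subalgebra generated by the root spaces of a set of roots. -/
def generated (P : Set (Module.Dual ℂ (cartan T))) : LieSubalgebra ℂ (g T) :=
  LieSubalgebra.lieSpan ℂ (g T) (⋃ α ∈ P, (rootSpace α : Set (g T)))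

/-- The parabolic subalgebra `p(≺)`. -/
def parabolic : LieSubalgebra ℂ (g T) := cartan T ⊔ generated T (rootsZero T r ∪ rootsPos T r)

/-- The reductive component `l(≺)`. -/
def levi : LieSubalgebra ℂ (g T) := cartan T ⊔ generated T (rootsZero T r)

/-- The locally nilpotent radical `u(≺)`. -/
def nilrad : LieSubalgebra ℂ (g T) := generated T (rootsPos T r)

/-- `l(≺)^ss = [l(≺), l(≺)]`. -/
def leviSS : LieSubalgebra ℂ (g T) :=
  LieSubalgebra.lieSpan ℂ (g T) {z | ∃ x ∈ levi T r, ∃ y ∈ levi T r, z = ⁅x, y⁆}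

/-- The component `g[p]` of `l(≺)^ss`, generated by the root spaces of the roots `ε_a - ε_b` with
`a, b ∈ [p]`. -/
def component (p : ℤ) : LieSubalgebra ℂ (g T) :=
  generated T {α | α ∈ roots T ∧ ∃ a b : Idx T ℕ+, α = eps a - eps b ∧
    a.toInt ∈ cls r p ∧ b.toInt ∈ cls r p}

/-- `sl(≺)`, the sum of the components `g[p]` with `[p] ≠ [0]`. -/
def slPart : LieSubalgebra ℂ (g T) := ⨆ (p : ℤ) (_ : cls r p ≠ cls r 0), component T r p

/-- `[0] ∩ ℤ_{>0}`. -/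
def zeroPos : Set ℕ+ := {k | ((k : ℕ) : ℤ) ∈ cls r 0}

/-- `l` is the direct sum of its ideals `a` and `b`. -/
def IsDirectSum (l a b : LieSubalgebra ℂ (g T)) : Prop :=
  a ⊓ b = ⊥ ∧ a.toSubmodule ⊔ b.toSubmodule = l.toSubmodule ∧ ∀ x ∈ a, ∀ y ∈ b, ⁅x, y⁆ = 0

section Modules

/-- The subspace `M^{u(≺)}`. -/
def invariants (M : Type) [AddCommGroup M] [Module ℂ M] [LieRingModule (g T) M]
    [LieModule ℂ (g T) M] : Submodule ℂ M where
  carrier := {m | ∀ x ∈ nilrad T r, ⁅x, m⁆ = 0}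
  zero_mem' x _ := lie_zero x
  add_mem' hm hn x hx := by rw [lie_add, hm x hx, hn x hx, add_zero]
  smul_mem' c m hm x hx := by rw [lie_smul, hm x hx, smul_zero]

open TensorProduct in
/-- The generalized Verma module `M_p(S) = U(g) ⊗_{U(p)} S`. -/
abbrev Verma (p : LieSubalgebra ℂ (g T)) (S : Type) [AddCommGroup S] [Module ℂ S]
    [LieRingModule p S] [LieModule ℂ p S] : Type :=
  (UniversalEnvelopingAlgebra ℂ (g T) ⊗[ℂ] S) ⧸
    Submodule.span (UniversalEnvelopingAlgebra ℂ (g T))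
      {t : UniversalEnvelopingAlgebra ℂ (g T) ⊗[ℂ] S | ∃ (u : UniversalEnvelopingAlgebra ℂ (g T))
        (x : p) (s : S), t = (u * UniversalEnvelopingAlgebra.ι ℂ (x : g T)) ⊗ₜ[ℂ] s
          - u ⊗ₜ[ℂ] ⁅x, s⁆}

/-- `M` is `p(≺)`-aligned: it is a simple quotient of `M_p(S)` for a `p(≺)`-module `S` on which
`u(≺)` acts by zero and which is a simple weight module over `l(≺)`. -/
def IsAligned (M : Type) [AddCommGroup M] [Module ℂ M] [LieRingModule (g T) M]
    [LieModule ℂ (g T) M] : Prop :=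
  LieModule.IsIrreducible ℂ (g T) M ∧
  ∃ (S : Type) (_ : AddCommGroup S) (_ : Module ℂ S) (_ : LieRingModule (parabolic T r) S)
    (_ : LieModule ℂ (parabolic T r) S),
    (∀ x : parabolic T r, (x : g T) ∈ nilrad T r → ∀ s : S, ⁅x, s⁆ = 0) ∧
    Nontrivial S ∧
    (∀ N : Submodule ℂ S,
      (∀ x : parabolic T r, (x : g T) ∈ levi T r → ∀ s ∈ N, ⁅x, s⁆ ∈ N) → N = ⊥ ∨ N = ⊤) ∧
    Submodule.span ℂ {s : S | ∃ μ : Module.Dual ℂ (cartan T), ∀ (H : cartan T)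
      (hH : (H : g T) ∈ parabolic T r), ⁅(⟨H, hH⟩ : parabolic T r), s⁆ = μ H • s} = ⊤ ∧
    ∃ f : Verma T (parabolic T r) S →ₗ[ℂ] M, Function.Surjective f ∧
      ∀ (X : g T) (t : Verma T (parabolic T r) S),
        f (UniversalEnvelopingAlgebra.ι ℂ X • t) = ⁅X, f t⁆

/-- `M^{u(≺)} ≅ N ⊠ ℂ` over the sum of the image of `o(κ)` under the relabelling `e` and of
`sl(≺)`: the former acts on `N`, the latter acts trivially. -/
def InvariantsIso {κ : Type} (e : κ ↪ ℕ+) (N M : Type) [AddCommGroup N] [Module ℂ N]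
    [LieRingModule (o T κ) N] [LieModule ℂ (o T κ) N] [AddCommGroup M] [Module ℂ M]
    [LieRingModule (g T) M] [LieModule ℂ (g T) M] : Prop :=
  ∃ φ : N ≃ₗ[ℂ] invariants T r M, ∀ (X : o T κ), ∀ Y ∈ slPart T r, ∀ n : N,
    ⁅o.map T e X + Y, (φ n : M)⁆ = (φ ⁅X, n⁆ : M)

end Modules

/-- Compatibility of `≺` with `A'`: elements of `A'` are `≺ 0` or in `[0]`, the other positive
integers are `≻ 0` or in `[0]`. -/
def Compatible (A' : Set ℕ+) : Prop :=
  (∀ k ∈ A', r (k : ℕ) 0 ∨ ((k : ℕ) : ℤ) ∈ cls r 0) ∧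
  (∀ k ∉ A', r 0 (k : ℕ) ∨ ((k : ℕ) : ℤ) ∈ cls r 0)

/-- `A' ∼_B A` (finite difference), respectively `A' ∼_D A` (even finite difference). -/
def Sim (A' A : Set ℕ+) : Prop :=
  (symmDiff A' A).Finite ∧ (T = SpinType.D → Even (symmDiff A' A).ncard)

end OInf
end

/-! For `b ≠ -a` the root vector `rootVec a b` acts on the Fock space as the product `γ_a γ_b` of
two Clifford generators (`rho_rootVec`). Each `γ_a` sends a basis vector to zero or to a nonzero
multiple of a basis vector, distinct labels having distinct targets (`coeff_gamma`). Nothing can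
cancel, so `γ_a γ_b` kills a vector iff it kills every basis vector occurring in it.

The algebra `u(≺)` is generated by the `rootVec a b` with `a ≺ -b`, and `A ∆ F` is compatible with
`≺` iff every `γ_a` with `a ≺ 0` kills the basis vector `F` (`compatible_iff`). The invariants are
therefore the vectors supported on compatible labels. In one direction, `a ≺ -b` forces `a ≺ 0` or
`b ≺ 0` (`mem_invariants_of_compatible`). In the other, given `a ≺ 0` that does not kill `F`, one
finds `b ≠ ±a` with `a ≺ -b` that does not kill `F` either: `b` lies in `[0]` when an index is
available there, and otherwise a parity count supplies it (`compatible_of_mem_invariants`). For a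
root of a component with `[p] ≠ [0]` one of the two factors is again `≺ 0`, so `sl(≺)` acts by zero
(`slPart_lie_eq_zero`).

Two compatible sets differ only inside `J`, and inside `J` compatibility is no condition. The
compatible labels are thus translates of the finite subsets of `J`, and `fockMap` identifies the
Fock space over `J` with their span, intertwining Clifford generators up to one global sign, which
disappears in products of two (`rho_fockMap`). Replacing `A'` by another compatible set of the same
parity puts the finite cases in standard form.

On the Lie algebra side the root spaces are lines spanned by root vectors, and `o([0])` and `sl(≺)`
act on complementary sets of basis vectors. This gives the direct sum (`isDirectSum_leviSS`) and
identifies `o([0])` (`component_zero_eq_range`). -/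

noncomputable section

attribute [local instance] LieRing.ofAssociativeRing

namespace OInf

/-! ### Skew endomorphisms `u ∧ w` and their action by Clifford elements. -/

section Wedge

variable {T : SpinType} {ι κ : Type}

theorem Idx.opp_inj {a b : Idx T ι} : a.opp = b.opp ↔ a = b :=
  ⟨fun h => by rw [← Idx.opp_opp a, h, Idx.opp_opp], fun h => h ▸ rfl⟩

theorem Idx.opp_eq_iff {a b : Idx T ι} : a.opp = b ↔ a = b.opp := by
  rw [← Idx.opp_inj, Idx.opp_opp]

/-- The skew endomorphism `v ↦ (w, v) u - (u, v) w` of the natural module. -/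
def wedge (u w : NatMod T ι) : o T ι :=
  ⟨(form T ι w).smulRight u - (form T ι u).smulRight w, by
    constructor
    · refine (LinearMap.mem_skewAdjointSubmodule _).2 fun v x => ?_
      simp only [LinearMap.sub_apply, LinearMap.smulRight_apply, map_sub, map_smul, Pi.neg_apply,
        LinearMap.smul_apply, smul_eq_mul, map_neg]
      rw [form_comm v u, form_comm v w]
      ring
    · classical
      refine ((u.support ∪ w.support).image Idx.opp).finite_toSet.subset fun a ha => ?_
      by_contra h
      apply ha
      have hu : u a.opp = 0 := by
        by_contra h'
        exact h (by simpa using ⟨a.opp, Or.inl h', Idx.opp_opp a⟩)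
      have hw : w a.opp = 0 := by
        by_contra h'
        exact h (by simpa using ⟨a.opp, Or.inr h', Idx.opp_opp a⟩)
      simp [form_comm _ (Finsupp.single a (1 : ℂ)), form_single, hu, hw]⟩

theorem wedge_apply (u w v : NatMod T ι) :
    (wedge u w).1 v = form T ι w v • u - form T ι u v • w := rfl

theorem wedge_swap (u w : NatMod T ι) : wedge w u = - wedge u w := by
  apply Subtype.ext
  refine LinearMap.ext fun v => ?_
  change (wedge w u).1 v = - (wedge u w).1 v
  simp [wedge_apply]

theorem wedge_self (u : NatMod T ι) : wedge u u = 0 := by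
  apply Subtype.ext
  refine LinearMap.ext fun v => ?_
  simp [wedge_apply]

theorem wedge_neg_right (u w : NatMod T ι) : wedge u (-w) = - wedge u w := by
  apply Subtype.ext
  refine LinearMap.ext fun v => ?_
  change (wedge u (-w)).1 v = - (wedge u w).1 v
  simp [wedge_apply]
  abel

theorem lie_apply (X Y : o T ι) (v : NatMod T ι) : ⁅X, Y⁆.1 v = X.1 (Y.1 v) - Y.1 (X.1 v) := rfl

theorem lie_wedge (X : o T ι) (u w : NatMod T ι) :
    ⁅X, wedge u w⁆ = wedge (X.1 u) w + wedge u (X.1 w) := by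
  apply Subtype.ext
  refine LinearMap.ext fun v => ?_
  change ⁅X, wedge u w⁆.1 v = (wedge (X.1 u) w).1 v + (wedge u (X.1 w)).1 v
  simp only [lie_apply, wedge_apply, map_sub, map_smul, o_skew, neg_smul]
  abel

theorem form_single_single [DecidableEq (Idx T ι)] (a b : Idx T ι) :
    form T ι (Finsupp.single a 1) (Finsupp.single b 1) = if b = a.opp then 1 else 0 := by
  rw [form_single, Finsupp.single_apply]

/-- The element of `o(V)` sending `e_{-b}` to `e_a` and `e_{-a}` to `-e_b`. -/
def rootVec (a b : Idx T ι) : o T ι := wedge (Finsupp.single a 1) (Finsupp.single b 1)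

open Classical in
theorem rootVec_single (a b c : Idx T ι) :
    (rootVec a b).1 (Finsupp.single c 1) =
      (if c = b.opp then Finsupp.single a 1 else 0) -
        (if c = a.opp then Finsupp.single b 1 else 0) := by
  rw [rootVec, wedge_apply, form_single_single, form_single_single]
  split_ifs <;> simp

theorem o_ext {X Y : o T ι}
    (h : ∀ a, X.1 (Finsupp.single a 1) = Y.1 (Finsupp.single a 1)) : X = Y :=
  Subtype.ext (Finsupp.lhom_ext' fun a => LinearMap.ext_ring (h a))

theorem map_apply (e : κ ↪ ι) (X : o T κ) (v : NatMod T ι) :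
    (o.map T e X).1 v = ext T e (X.1 (res T e v)) := rfl

theorem map_wedge (e : κ ↪ ι) (u w : NatMod T κ) :
    o.map T e (wedge u w) = wedge (ext T e u) (ext T e w) := by
  apply Subtype.ext
  refine LinearMap.ext fun v => ?_
  rw [map_apply, wedge_apply, wedge_apply, form_ext, form_ext, map_sub, map_smul, map_smul]

theorem map_rootVec (e : κ ↪ ι) (a b : Idx T κ) :
    o.map T e (rootVec a b) = rootVec (a.map e) (b.map e) := by
  rw [rootVec, map_wedge, ext_single, ext_single, rootVec]

variable [LinearOrder ι] {A : Set ι}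

/-- Applied to `v`, each of the two halves of the wedges sums to `X v`, the second by skewness;
hence the factor `1/2`. -/
theorem eq_sum_wedge (X : o T ι) (s : Finset (Idx T ι))
    (hs : ∀ b, X.1 (Finsupp.single b 1) ≠ 0 → b ∈ s) :
    X = (1 / 2 : ℂ) • ∑ b ∈ s, wedge (X.1 (Finsupp.single b 1)) (Finsupp.single b.opp 1) := by
  apply Subtype.ext
  refine LinearMap.ext fun v => ?_
  have h : (((1 / 2 : ℂ) • ∑ b ∈ s, wedge (X.1 (Finsupp.single b 1))
      (Finsupp.single b.opp 1) : o T ι)).1 v =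
      (1 / 2 : ℂ) • ∑ b ∈ s, (wedge (X.1 (Finsupp.single b 1)) (Finsupp.single b.opp 1)).1 v := by
    simp
  rw [h]
  simp only [wedge_apply, Finset.sum_sub_distrib, form_comm _ v]
  have h1 := sum_form X s hs v
  have h2 := sum_form' X s hs v
  simp only [form_comm _ v] at h1
  rw [h1, h2, sub_neg_eq_add, ← two_smul ℂ, smul_smul]
  norm_num

/-- Expanding each `X e_b` of `eq_sum_wedge` in the basis shows that the root vectors span. Linear
statements about the orthogonal algebra can thus be tested on them. -/
theorem mem_of_rootVec_mem (K : Submodule ℂ (o T ι)) (h : ∀ a b, rootVec a b ∈ K) (X : o T ι) :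
    X ∈ K := by
  obtain ⟨s, hs⟩ := exists_bound X
  rw [eq_sum_wedge X s hs]
  refine K.smul_mem _ (K.sum_mem fun b _ => ?_)
  have key : ∀ u : NatMod T ι, wedge u (Finsupp.single b.opp 1) =
      u.sum fun a c => c • rootVec a b.opp := fun u => by
    let L : NatMod T ι →ₗ[ℂ] o T ι :=
      { toFun := fun u => wedge u (Finsupp.single b.opp 1)
        map_add' := fun u v => by
          apply Subtype.ext
          refine LinearMap.ext fun x => ?_
          simp [wedge_apply, add_smul]
          abel
        map_smul' := fun c u => by
          apply Subtype.ext
          refine LinearMap.ext fun x => ?_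
          simp [wedge_apply, smul_sub, smul_smul, mul_comm] }
    change L u = _
    conv_lhs => rw [← Finsupp.sum_single u]
    rw [Finsupp.sum, Finsupp.sum, map_sum]
    refine Finset.sum_congr rfl fun a _ => ?_
    rw [← Finsupp.smul_single_one, map_smul]
    rfl
  rw [key]
  exact K.sum_mem fun a _ => K.smul_mem _ (h _ _)

theorem rho_wedge (u w : NatMod T ι) :
    rho T A (wedge u w) =
      (1 / 2 : ℂ) • (psi T A u * psi T A w - psi T A w * psi T A u) := by
  obtain ⟨s, hs⟩ := exists_bound (wedge u w)
  classical
  -- The two terms of the wedge may cancel on a basis vector, so `s` can be too small for the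
  -- separate expansions of `u` and `w`.
  set t := s ∪ (u.support ∪ w.support).image Idx.opp with ht
  have aux : ∀ v : NatMod T ι, v.support ⊆ u.support ∪ w.support →
      ∑ b ∈ t, form T ι v (Finsupp.single b 1) • Finsupp.single b.opp (1 : ℂ) = v := by
    intro v hv
    ext a
    simp only [form_comm v, form_single, Finsupp.coe_finsetSum, Finset.sum_apply,
      Finsupp.smul_apply, Finsupp.single_apply, smul_eq_mul, mul_ite, mul_one, mul_zero,
      Idx.opp_eq_iff, Finset.sum_ite_eq', Idx.opp_opp]
    split_ifs with h
    · rfl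
    · by_contra h'
      exact h (Finset.mem_union_right _ (Finset.mem_image.2
        ⟨a, hv (Finsupp.mem_support_iff.2 (Ne.symm h')), rfl⟩))
  have hu := congrArg (psi T A) (aux u Finset.subset_union_left)
  have hw := congrArg (psi T A) (aux w Finset.subset_union_right)
  rw [map_sum] at hu hw
  rw [rho_eq _ t fun b hb => Finset.mem_union_left _ (hs b hb)]
  simp only [map_smul] at hu hw
  simp only [wedge_apply, map_sub, map_smul, sub_mul, Finset.sum_sub_distrib, smul_mul_assoc]
  simp only [← mul_smul_comm]
  rw [← Finset.mul_sum, ← Finset.mul_sum, hu, hw]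

/-- Here the two generators anticommute, so half their commutator is their product. -/
theorem rho_rootVec {a b : Idx T ι} (h : b ≠ a.opp) :
    rho T A (rootVec a b) = gamma T A a * gamma T A b := by
  classical
  have h1 := psi_clifford (A := A) (Finsupp.single a (1 : ℂ)) (Finsupp.single b 1)
  rw [form_single_single, if_neg h, zero_smul, add_eq_zero_iff_neg_eq] at h1
  rw [rootVec, rho_wedge, ← h1, sub_neg_eq_add, ← two_smul ℂ, smul_smul]
  norm_num
  rw [psi_single, psi_single]

theorem gamma_anticomm {a b : Idx T ι} (h : b ≠ a.opp) :
    gamma T A a * gamma T A b = - (gamma T A b * gamma T A a) := by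
  classical
  have h1 := gamma_clifford (A := A) a b
  rw [Finsupp.single_apply, if_neg h, zero_smul] at h1
  exact eq_neg_of_add_eq_zero_left h1

end Wedge

/-! ### Admissible orders: incomparability as an equivalence relation. -/

section Order

variable {r : ℤ → ℤ → Prop} {a b c : ℤ}

theorem mem_cls_self (r : ℤ → ℤ → Prop) (a : ℤ) : a ∈ cls r a := Or.inl rfl

theorem mem_cls_comm : a ∈ cls r b ↔ b ∈ cls r a := by
  simp only [cls, Set.mem_union, Set.mem_singleton_iff, Set.mem_ofPred_eq]
  tauto

theorem cls_eq (hadm : Admissible r) (h : a ∈ cls r b) : cls r a = cls r b := by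
  by_contra hne
  exact Set.disjoint_left.1 (hadm a b hne) (mem_cls_self r a) h

theorem mem_cls_trans (hadm : Admissible r) (h : a ∈ cls r b) (h' : b ∈ cls r c) : a ∈ cls r c :=
  cls_eq hadm h' ▸ h

theorem notMem_cls_of_rel (hr : IsStrictOrder ℤ r) (h : r a b) : a ∉ cls r b := by
  rintro (rfl | h')
  · exact hr.irrefl _ h
  · exact h'.2 h

theorem rel_trichotomy (a b : ℤ) : r a b ∨ r b a ∨ a ∈ cls r b := by
  simp only [cls, Set.mem_union, Set.mem_singleton_iff, Set.mem_ofPred_eq]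
  tauto

/-- Together with the next lemma: admissibility makes incomparability transitive, so `≺` depends
only on classes. -/
theorem rel_of_rel_of_mem_cls (hr : IsStrictOrder ℤ r) (hadm : Admissible r) (h : r a c)
    (hb : b ∈ cls r c) : r a b := by
  rcases rel_trichotomy (r := r) a b with h' | h' | h'
  · exact h'
  · exact absurd hb (notMem_cls_of_rel hr (hr.trans _ _ _ h' h))
  · exact absurd (mem_cls_trans hadm h' hb) (notMem_cls_of_rel hr h)

theorem rel_of_mem_cls_of_rel (hr : IsStrictOrder ℤ r) (hadm : Admissible r) (h : r c a)
    (hb : b ∈ cls r c) : r b a := by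
  rcases rel_trichotomy (r := r) b a with h' | h' | h'
  · exact h'
  · exact absurd (mem_cls_comm.1 hb) (notMem_cls_of_rel hr (hr.trans _ _ _ h h'))
  · exact absurd (mem_cls_trans hadm (mem_cls_comm.1 hb) h') (notMem_cls_of_rel hr h)

theorem neg_mem_cls_neg (hlin : Z2Linear r) (h : a ∈ cls r b) : -a ∈ cls r (-b) := by
  rcases h with rfl | h
  · exact mem_cls_self r _
  · exact Or.inr ⟨fun h' => h.2 ((hlin _ _).2 h'), fun h' => h.1 ((hlin _ _).2 h')⟩

theorem neg_mem_cls_zero (hlin : Z2Linear r) (h : a ∈ cls r 0) : -a ∈ cls r 0 := by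
  simpa using neg_mem_cls_neg hlin h

theorem rel_zero_neg (hlin : Z2Linear r) : r (-a) 0 ↔ r 0 a := by
  rw [hlin 0 a, neg_zero]

end Order

/-! ### Roots and root spaces. -/

section Roots

variable {T : SpinType}

theorem Idx.toInt_opp (a : Idx T ℕ+) : a.opp.toInt = -a.toInt := by
  cases a <;> simp [Idx.opp, Idx.toInt]

theorem Idx.toInt_injective : Function.Injective (Idx.toInt (T := T)) := by
  intro a b h
  cases a with
  | zero _ =>
    cases b with
    | zero _ => rfl
    | pos j => have := j.pos; simp only [Idx.toInt] at h; omega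
    | neg j => have := j.pos; simp only [Idx.toInt] at h; omega
  | pos i =>
    have hi := i.pos
    cases b with
    | zero _ => simp only [Idx.toInt] at h; omega
    | pos j => simp only [Idx.toInt] at h; congr 1; exact PNat.eq (by omega)
    | neg j => have := j.pos; simp only [Idx.toInt] at h; omega
  | neg i =>
    have hi := i.pos
    cases b with
    | zero _ => simp only [Idx.toInt] at h; omega
    | pos j => have := j.pos; simp only [Idx.toInt] at h; omega
    | neg j => simp only [Idx.toInt] at h; congr 1; exact PNat.eq (by omega)

theorem cartan_single (H : cartan T) (a : Idx T ℕ+) :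
    H.1.1 (Finsupp.single a 1) = eps a H • Finsupp.single a 1 := by
  obtain ⟨c, hc⟩ := H.2 a
  have : eps a H = c := by
    change H.1.1 (Finsupp.single a 1) a = c
    rw [hc, Finsupp.single_eq_same]
  rw [hc, this, Finsupp.smul_single_one]

theorem eps_opp (a : Idx T ℕ+) : eps a.opp = - eps a := by
  classical
  ext H
  have h := o_skew H.1 (Finsupp.single a 1) (Finsupp.single a.opp 1)
  rw [cartan_single, cartan_single, map_smul, map_smul, LinearMap.smul_apply,
    form_single_single] at h
  simpa using (neg_eq_iff_eq_neg.2 h).symm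

theorem wedge_smul_smul {ι : Type} (c d : ℂ) (u w : NatMod T ι) :
    wedge (c • u) w + wedge u (d • w) = (c + d) • wedge u w := by
  apply Subtype.ext
  refine LinearMap.ext fun v => ?_
  change (wedge (c • u) w).1 v + (wedge u (d • w)).1 v = (c + d) • (wedge u w).1 v
  simp only [wedge_apply, map_smul, LinearMap.smul_apply, smul_eq_mul]
  module

theorem lie_cartan_rootVec (H : cartan T) (a b : Idx T ℕ+) :
    ⁅(H : g T), rootVec a b⁆ = (eps a H + eps b H) • rootVec a b := by
  rw [rootVec, lie_wedge, cartan_single, cartan_single, wedge_smul_smul]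

/-- The element of the Cartan subalgebra with eigenvalue `1` on `e_k`, `-1` on `e_{-k}`, and `0` on
the other basis vectors. -/
def coroot (T : SpinType) (k : ℕ+) : cartan T :=
  ⟨rootVec (.pos k) (.neg k), fun a => by
    classical
    rw [rootVec_single]
    cases a with
    | pos i =>
      by_cases h : i = k
      · exact ⟨1, by simp [Idx.opp, h]⟩
      · exact ⟨0, by simp [Idx.opp, h]⟩
    | neg i =>
      by_cases h : i = k
      · exact ⟨-1, by simp [Idx.opp, h]⟩
      · exact ⟨0, by simp [Idx.opp, h]⟩
    | zero _ => exact ⟨0, by simp [Idx.opp]⟩⟩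

theorem eps_coroot (a : Idx T ℕ+) (k : ℕ+) :
    eps a (coroot T k) =
      (((if a.toInt = k then 1 else 0) - (if a.toInt = -k then 1 else 0) : ℤ) : ℂ) := by
  classical
  change (rootVec (.pos k) (.neg k)).1 (Finsupp.single a 1) a = _
  have h1 : a.toInt = k ↔ a = .pos k := Idx.toInt_injective.eq_iff (b := Idx.pos k)
  have h2 : a.toInt = -k ↔ a = .neg k := Idx.toInt_injective.eq_iff (b := Idx.neg k)
  rw [rootVec_single]
  simp only [h1, h2, Idx.opp]
  cases a with
  | pos i => by_cases h : i = k <;> simp [h]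
  | neg i => by_cases h : i = k <;> simp [h]
  | zero _ => simp

/-- Evaluation at the coroots recovers the coordinates of a difference of weights. The only
ambiguity left is `(a, b) ↔ (-b, -a)`, because `ε_{-a} = -ε_a`. -/
theorem eps_sub_eq_iff {a b c d : Idx T ℕ+} (hab : a ≠ b)
    (h : eps a - eps b = eps c - eps d) : (c = a ∧ d = b) ∨ (c = b.opp ∧ d = a.opp) := by
  simp only [← Idx.toInt_injective.eq_iff, Idx.toInt_opp]
  have hab' : a.toInt ≠ b.toInt := fun h' => hab (Idx.toInt_injective h')
  have key : ∀ n : ℤ, 0 < n →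
      ((if a.toInt = n then 1 else 0) - (if a.toInt = -n then 1 else 0) : ℤ) -
      ((if b.toInt = n then 1 else 0) - (if b.toInt = -n then 1 else 0)) =
      ((if c.toInt = n then 1 else 0) - (if c.toInt = -n then 1 else 0)) -
      ((if d.toInt = n then 1 else 0) - (if d.toInt = -n then 1 else 0)) := by
    intro n hn
    lift n to ℕ using hn.le
    have hk : ∃ k : ℕ+, (k : ℕ) = n := ⟨⟨n, by omega⟩, rfl⟩
    obtain ⟨k, rfl⟩ := hk
    have : eps a (coroot T k) - eps b (coroot T k) = eps c (coroot T k) - eps d (coroot T k) :=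
      LinearMap.congr_fun h (coroot T k)
    rw [eps_coroot, eps_coroot, eps_coroot, eps_coroot] at this
    exact_mod_cast this
  generalize a.toInt = a at *
  generalize b.toInt = b at *
  generalize c.toInt = c at *
  generalize d.toInt = d at *
  -- Both sides are odd in `n`. Taking `n` to be each of the four labels leaves a finite case
  -- analysis.
  have key' : ∀ n : ℤ, n ≠ 0 →
      ((if a = n then 1 else 0) - (if a = -n then 1 else 0) : ℤ) -
      ((if b = n then 1 else 0) - (if b = -n then 1 else 0)) =
      ((if c = n then 1 else 0) - (if c = -n then 1 else 0)) -
      ((if d = n then 1 else 0) - (if d = -n then 1 else 0)) := by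
    intro n hn
    rcases lt_or_gt_of_ne hn with h | h
    · have := key (-n) (by omega)
      rw [neg_neg] at this
      linarith
    · exact key n h
  have ka := key' a
  have kb := key' b
  have kc := key' c
  have kd := key' d
  clear key key' h hab
  by_cases a0 : a = 0 <;> by_cases b0 : b = 0 <;> grind

theorem eps_sub_ne_zero {a b : Idx T ℕ+} (hab : a ≠ b) : eps a - eps b ≠ 0 := by
  intro h
  rw [← sub_self (eps a)] at h
  rcases eps_sub_eq_iff hab h with ⟨_, h'⟩ | ⟨h', h''⟩
  · exact hab h'
  · exact hab (by rw [← Idx.opp_inj, ← h', ← h''])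

theorem rootVec_mem_rootSpace (a b : Idx T ℕ+) : rootVec a b.opp ∈ rootSpace (eps a - eps b) := by
  intro H
  rw [lie_cartan_rootVec, eps_opp]
  rfl

theorem rootVec_ne_zero {ι : Type} {a b : Idx T ι} (h : a ≠ b) : rootVec a b ≠ 0 := by
  classical
  intro h0
  have h1 := rootVec_single a b b.opp
  rw [h0, if_pos rfl, if_neg fun h' => h (Idx.opp_inj.1 h').symm, sub_zero] at h1
  have := DFunLike.congr_fun h1 a
  simp at this

/-- Under the bracket with `H` the matrix entry of `x` at `(c, d)` is multiplied by `(ε_c -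
ε_d)(H)`, so a nonzero entry determines the root. -/
theorem eq_eps_sub_of_mem_rootSpace {α : Module.Dual ℂ (cartan T)} {x : g T}
    (hx : x ∈ rootSpace α) {c d : Idx T ℕ+} (hne : x.1 (Finsupp.single d 1) c ≠ 0) :
    α = eps c - eps d := by
  ext H
  have h1 : ⁅(H : g T), x⁆.1 (Finsupp.single d 1) c = (α H • x).1 (Finsupp.single d 1) c := by
    rw [hx H]
  rw [lie_apply, cartan_single, map_smul] at h1
  have h2 : H.1.1 (x.1 (Finsupp.single d 1)) c = eps c H * x.1 (Finsupp.single d 1) c := by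
    have := o_skew H.1 (Finsupp.single c.opp 1) (x.1 (Finsupp.single d 1))
    rw [cartan_single, map_smul, LinearMap.smul_apply, form_single, form_single, Idx.opp_opp,
      eps_opp] at this
    simp only [LinearMap.neg_apply, smul_eq_mul] at this
    linear_combination this
  have h3 : (α H • x).1 (Finsupp.single d 1) c = α H * x.1 (Finsupp.single d 1) c := rfl
  rw [h3, Finsupp.sub_apply, h2, Finsupp.smul_apply, smul_eq_mul, ← sub_mul] at h1
  exact (mul_right_cancel₀ hne h1).symm

theorem exists_eq_eps_sub {α : Module.Dual ℂ (cartan T)} (hα : α ∈ roots T) :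
    ∃ a b : Idx T ℕ+, α = eps a - eps b := by
  obtain ⟨x, hx, h0⟩ := (Submodule.ne_bot_iff _).1 hα.2
  by_contra! h
  refine h0 (o_ext fun d => Finsupp.ext fun c => ?_)
  by_contra hne
  exact h c d (eq_eps_sub_of_mem_rootSpace hx hne)

/-- By `eps_sub_eq_iff` only the matrix entries at `(a, b)` and `(-b, -a)` can be nonzero, and
skewness makes them negatives of each other. -/
theorem mem_rootSpace_eps_sub {a b : Idx T ℕ+} (hab : a ≠ b) {x : g T}
    (hx : x ∈ rootSpace (eps a - eps b)) : ∃ c : ℂ, x = c • rootVec a b.opp := by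
  classical
  have h0 : ∀ c d, x.1 (Finsupp.single d 1) c ≠ 0 →
      (c = a ∧ d = b) ∨ (c = b.opp ∧ d = a.opp) := fun c d hne =>
    eps_sub_eq_iff hab (eq_eps_sub_of_mem_rootSpace hx hne)
  have hskew : x.1 (Finsupp.single a.opp 1) b.opp = - x.1 (Finsupp.single b 1) a := by
    have := o_skew x (Finsupp.single a.opp 1) (Finsupp.single b 1)
    rwa [form_comm, form_single, form_single, Idx.opp_opp] at this
  refine ⟨x.1 (Finsupp.single b 1) a, o_ext fun d => Finsupp.ext fun c => ?_⟩
  have h4 : ((x.1 (Finsupp.single b 1) a • rootVec a b.opp : g T).1 (Finsupp.single d 1)) c =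
    x.1 (Finsupp.single b 1) a * (rootVec a b.opp).1 (Finsupp.single d 1) c := rfl
  rw [h4, rootVec_single, Idx.opp_opp]
  by_cases h5 : b = a.opp
  -- For `b = -a` the two positions coincide and the entry equals its own negative: `2ε_a` is not a
  -- root.
  · have h6 : x.1 (Finsupp.single b 1) a = 0 := by
      have h8 := hskew
      rw [← h5, h5, Idx.opp_opp, ← h5] at h8
      linear_combination (1 / 2 : ℂ) * h8
    rw [h6, zero_mul]
    by_contra hne
    rcases h0 c d hne with ⟨rfl, rfl⟩ | ⟨rfl, rfl⟩
    · exact hne h6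
    · apply hne
      rw [hskew, h6, neg_zero]
  · by_cases hz : x.1 (Finsupp.single d 1) c = 0
    · rw [hz]
      by_cases hd : d = b
      · subst hd
        by_cases hc : c = a
        · subst hc
          rw [hz, zero_mul]
        · simp [h5, Ne.symm hc]
      · by_cases hd' : d = a.opp
        · subst hd'
          by_cases hc : c = b.opp
          · subst hc
            rw [hskew, neg_eq_zero] at hz
            rw [hz, zero_mul]
          · simp [hd, Ne.symm hc]
        · simp [hd, hd']
    · rcases h0 c d hz with ⟨rfl, rfl⟩ | ⟨rfl, rfl⟩
      · simp [h5]
      · rw [hskew]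
        simp [Ne.symm h5]

theorem eps_sub_mem_roots {a b : Idx T ℕ+} (hab : a ≠ b) (h : a ≠ b.opp) :
    eps a - eps b ∈ roots T :=
  ⟨eps_sub_ne_zero hab, fun h0 => rootVec_ne_zero h
    ((Submodule.mem_bot ℂ).1 (h0 ▸ rootVec_mem_rootSpace a b))⟩

theorem mem_rootSpace_of_mem_roots {a b : Idx T ℕ+} (h : eps a - eps b ∈ roots T) {x : g T}
    (hx : x ∈ rootSpace (eps a - eps b)) : ∃ c : ℂ, x = c • rootVec a b.opp :=
  mem_rootSpace_eps_sub (fun h' => h.1 (by rw [h', sub_self])) hx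

theorem ne_of_mem_roots {a b : Idx T ℕ+} (h : eps a - eps b ∈ roots T) : a ≠ b ∧ a ≠ b.opp := by
  refine ⟨fun h' => h.1 (by rw [h', sub_self]), fun h' => h.2 ?_⟩
  rw [eq_bot_iff]
  intro x hx
  obtain ⟨c, rfl⟩ := mem_rootSpace_of_mem_roots h hx
  rw [← h', rootVec, wedge_self, smul_zero]
  exact zero_mem _

theorem generated_le {P : Set (Module.Dual ℂ (cartan T))} {K : LieSubalgebra ℂ (g T)}
    (h : ∀ α ∈ P, ∀ x ∈ rootSpace α, x ∈ K) : generated T P ≤ K := by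
  refine LieSubalgebra.lieSpan_le.2 fun x hx => ?_
  simp only [Set.mem_iUnion] at hx
  obtain ⟨α, hα, hx⟩ := hx
  exact h α hα x hx

theorem rootSpace_le_generated {P : Set (Module.Dual ℂ (cartan T))} {α : Module.Dual ℂ (cartan T)}
    (hα : α ∈ P) {x : g T} (hx : x ∈ rootSpace α) : x ∈ generated T P :=
  LieSubalgebra.subset_lieSpan (Set.mem_biUnion hα hx)

variable {r : ℤ → ℤ → Prop}

theorem rootVec_mem_nilrad {a b : Idx T ℕ+} (h : r a.toInt b.opp.toInt) (h1 : a ≠ b)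
    (h2 : a ≠ b.opp) : rootVec a b ∈ nilrad T r := by
  refine rootSpace_le_generated (P := rootsPos T r) (α := eps a - eps b.opp)
    ⟨eps_sub_mem_roots h2 (by rwa [Idx.opp_opp]), a, b.opp, rfl, h⟩ ?_
  simpa [Idx.opp_opp] using rootVec_mem_rootSpace a b.opp

theorem nilrad_le {K : LieSubalgebra ℂ (g T)} (h : ∀ a b : Idx T ℕ+, r a.toInt b.opp.toInt →
    a ≠ b → a ≠ b.opp → rootVec a b ∈ K) : nilrad T r ≤ K := by
  refine generated_le ?_
  rintro _ ⟨hα, a, b, rfl, hab⟩ x hx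
  obtain ⟨c, rfl⟩ := mem_rootSpace_of_mem_roots hα hx
  obtain ⟨h1, h2⟩ := ne_of_mem_roots hα
  exact K.smul_mem _ (h a b.opp (by rwa [Idx.opp_opp]) h2 (by rwa [Idx.opp_opp]))

theorem rootVec_mem_component {p : ℤ} {a b : Idx T ℕ+} (ha : a.toInt ∈ cls r p)
    (hb : b.opp.toInt ∈ cls r p) (h1 : a ≠ b) (h2 : a ≠ b.opp) :
    rootVec a b ∈ component T r p := by
  have hx := rootVec_mem_rootSpace a b.opp
  rw [Idx.opp_opp] at hx
  exact LieSubalgebra.subset_lieSpan (Set.mem_biUnion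
    (show eps a - eps b.opp ∈ {α | α ∈ roots T ∧ ∃ a b : Idx T ℕ+, α = eps a - eps b ∧
      a.toInt ∈ cls r p ∧ b.toInt ∈ cls r p} from
      ⟨eps_sub_mem_roots h2 (by rwa [Idx.opp_opp]), a, b.opp, rfl, ha, hb⟩) hx)

theorem component_le {p : ℤ} {K : LieSubalgebra ℂ (g T)} (h : ∀ a b : Idx T ℕ+,
    a.toInt ∈ cls r p → b.opp.toInt ∈ cls r p → a ≠ b → a ≠ b.opp → rootVec a b ∈ K) :
    component T r p ≤ K := by
  refine generated_le ?_
  rintro _ ⟨hα, a, b, rfl, ha, hb⟩ x hx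
  obtain ⟨c, rfl⟩ := mem_rootSpace_of_mem_roots hα hx
  obtain ⟨h1, h2⟩ := ne_of_mem_roots hα
  exact K.smul_mem _ (h a b.opp ha (by rwa [Idx.opp_opp]) h2 (by rwa [Idx.opp_opp]))

end Roots

/-! ### The decomposition of `l(≺)^ss` and the identification of `o([0])`. -/

section Structure

variable {T : SpinType} {r : ℤ → ℤ → Prop}

/-- The elements of `o(∞)` that kill the basis vectors indexed by `S`. -/
def killing (S : Set (Idx T ℕ+)) : LieSubalgebra ℂ (g T) where
  carrier := {X | ∀ a ∈ S, X.1 (Finsupp.single a 1) = 0}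
  zero_mem' a _ := rfl
  add_mem' {X Y} hX hY a ha := by
    change X.1 _ + Y.1 _ = 0
    rw [hX a ha, hY a ha, add_zero]
  smul_mem' c X hX a ha := by
    change c • X.1 _ = 0
    rw [hX a ha, smul_zero]
  lie_mem' {X Y} hX hY a ha := by
    rw [lie_apply, hX a ha, hY a ha, map_zero, map_zero, sub_zero]

theorem apply_eq_zero_of_mem_killing {S : Set (Idx T ℕ+)} {X : g T} (hX : X ∈ killing S)
    {v : NatMod T ℕ+} (hv : ∀ a ∉ S, v a = 0) : X.1 v = 0 := by
  rw [← Finsupp.sum_single v, Finsupp.sum, map_sum]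
  refine Finset.sum_eq_zero fun a ha => ?_
  have haS : a ∈ S := by
    by_contra h
    exact Finsupp.mem_support_iff.1 ha (hv a h)
  rw [← Finsupp.smul_single_one, map_smul, hX a haS, smul_zero]

/-- By skewness, an operator that kills the `e_a` with `a` in a set closed under sign change also
has no such component in its image. This is what makes operators living on complementary index sets
commute. -/
theorem coeff_eq_zero_of_mem_killing {S : Set (Idx T ℕ+)} (hS : ∀ a ∈ S, a.opp ∈ S) {X : g T}
    (hX : X ∈ killing S) (v : NatMod T ℕ+) {a : Idx T ℕ+} (ha : a ∈ S) : X.1 v a = 0 := by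
  have := o_skew X (Finsupp.single a.opp 1) v
  rw [hX _ (hS a ha), map_zero, LinearMap.zero_apply, form_single, Idx.opp_opp] at this
  exact neg_eq_zero.1 this.symm

theorem rootVec_mem_killing {S : Set (Idx T ℕ+)} {a b : Idx T ℕ+} (ha : a.opp ∉ S)
    (hb : b.opp ∉ S) : rootVec a b ∈ killing S := by
  classical
  intro c hc
  rw [rootVec_single, if_neg, if_neg, sub_zero]
  · rintro rfl
    exact ha hc
  · rintro rfl
    exact hb hc

/-- The indices in `[0]`. -/
def zeroIdx (T : SpinType) (r : ℤ → ℤ → Prop) : Set (Idx T ℕ+) := {a | a.toInt ∈ cls r 0}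

theorem opp_mem_zeroIdx (hlin : Z2Linear r) {a : Idx T ℕ+} :
    a.opp ∈ zeroIdx T r ↔ a ∈ zeroIdx T r := by
  simp only [zeroIdx, Set.mem_ofPred_eq, Idx.toInt_opp]
  exact ⟨fun h => by simpa using neg_mem_cls_zero hlin h, neg_mem_cls_zero hlin⟩

theorem component_zero_le_killing (hlin : Z2Linear r) :
    component T r 0 ≤ killing (zeroIdx T r)ᶜ :=
  component_le fun _ _ ha hb _ _ => rootVec_mem_killing
    (fun h => h ((opp_mem_zeroIdx hlin).2 ha)) fun h => h hb

theorem slPart_le {K : LieSubalgebra ℂ (g T)} (h : ∀ p : ℤ, cls r p ≠ cls r 0 →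
    ∀ a b : Idx T ℕ+, a.toInt ∈ cls r p → b.opp.toInt ∈ cls r p → a ≠ b → a ≠ b.opp →
    rootVec a b ∈ K) : slPart T r ≤ K :=
  iSup₂_le fun p hp => component_le (h p hp)

theorem component_le_slPart {p : ℤ} (hp : cls r p ≠ cls r 0) : component T r p ≤ slPart T r :=
  le_iSup₂_of_le (f := fun (p : ℤ) (_ : cls r p ≠ cls r 0) => component T r p) p hp le_rfl

theorem slPart_le_killing (hadm : Admissible r) (hlin : Z2Linear r) :
    slPart T r ≤ killing (zeroIdx T r) := by
  refine slPart_le fun p hp a b ha hb _ _ => ?_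
  have key : ∀ c : Idx T ℕ+, c.toInt ∈ cls r p → c ∉ zeroIdx T r := fun c hc h =>
    hp ((cls_eq hadm hc).symm.trans (cls_eq hadm h))
  exact rootVec_mem_killing (fun h => key a ha ((opp_mem_zeroIdx hlin).1 h)) (key _ hb)

/-- One algebra kills the basis vectors outside `[0]`, the other those inside. -/
theorem component_inf_slPart (hadm : Admissible r) (hlin : Z2Linear r) :
    component T r 0 ⊓ slPart T r = ⊥ := by
  rw [eq_bot_iff]
  rintro X ⟨h1, h2⟩
  refine (LieSubalgebra.mem_bot X).2 (o_ext fun a => ?_)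
  by_cases ha : a ∈ zeroIdx T r
  · exact slPart_le_killing hadm hlin h2 a ha
  · exact component_zero_le_killing hlin h1 a ha

theorem lie_component_slPart (hadm : Admissible r) (hlin : Z2Linear r) {X Y : g T}
    (hX : X ∈ component T r 0) (hY : Y ∈ slPart T r) : ⁅X, Y⁆ = 0 := by
  have hX' := component_zero_le_killing hlin hX
  have hY' := slPart_le_killing hadm hlin hY
  refine o_ext fun a => ?_
  rw [lie_apply, apply_eq_zero_of_mem_killing hX', apply_eq_zero_of_mem_killing hY', sub_zero]
  · rfl
  · exact fun b hb => coeff_eq_zero_of_mem_killing (S := (zeroIdx T r)ᶜ)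
      (fun c hc h => hc ((opp_mem_zeroIdx hlin).1 h)) hX' _ hb
  · exact fun b hb => coeff_eq_zero_of_mem_killing
      (fun c hc => (opp_mem_zeroIdx hlin).2 hc) hY' _ (not_not.1 hb)

theorem lie_cartan_mem_generated {P : Set (Module.Dual ℂ (cartan T))} {H : g T}
    (hH : H ∈ cartan T) {x : g T} (hx : x ∈ generated T P) : ⁅H, x⁆ ∈ generated T P := by
  induction hx using LieSubalgebra.lieSpan_induction with
  | mem x hx =>
    simp only [Set.mem_iUnion] at hx
    obtain ⟨α, hα, hx⟩ := hx
    rw [hx ⟨H, hH⟩]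
    exact (generated T P).smul_mem _ (rootSpace_le_generated hα hx)
  | zero =>
    rw [lie_zero]
    exact zero_mem _
  | add x y _ _ hx hy =>
    rw [lie_add]
    exact add_mem hx hy
  | smul c x _ hx =>
    rw [lie_smul]
    exact (generated T P).smul_mem _ hx
  | lie x y hx hy hx' hy' =>
    rw [leibniz_lie]
    exact add_mem ((generated T P).lie_mem hx' hy) ((generated T P).lie_mem hx hy')

/-- Puts `sl(≺)` in a form to which `lie_cartan_mem_generated` applies, so that it is seen to be
stable under `h`. -/
theorem slPart_eq_generated : slPart T r =
    generated T {α | α ∈ roots T ∧ ∃ p, cls r p ≠ cls r 0 ∧ ∃ a b : Idx T ℕ+,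
      α = eps a - eps b ∧ a.toInt ∈ cls r p ∧ b.toInt ∈ cls r p} := by
  apply le_antisymm
  · refine iSup₂_le fun p hp => generated_le ?_
    rintro α ⟨hα, a, b, h⟩ x hx
    exact LieSubalgebra.subset_lieSpan (Set.mem_biUnion (by exact ⟨hα, p, hp, a, b, h⟩) hx)
  · refine generated_le ?_
    rintro α ⟨hα, p, hp, a, b, h⟩ x hx
    exact component_le_slPart hp
      (LieSubalgebra.subset_lieSpan (Set.mem_biUnion (by exact ⟨hα, a, b, h⟩) hx))

theorem lie_cartan_cartan {H K : g T} (hH : H ∈ cartan T) (hK : K ∈ cartan T) : ⁅H, K⁆ = 0 := by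
  refine o_ext fun a => ?_
  have h1 := cartan_single ⟨H, hH⟩ a
  have h2 := cartan_single ⟨K, hK⟩ a
  simp only at h1 h2
  rw [lie_apply, h1, h2, map_smul, map_smul, h1, h2, smul_comm, sub_self]
  rfl

/-- The sum of two commuting subalgebras. -/
def commutingSum (a b : LieSubalgebra ℂ (g T)) (h : ∀ x ∈ a, ∀ y ∈ b, ⁅x, y⁆ = 0) :
    LieSubalgebra ℂ (g T) where
  __ := a.toSubmodule ⊔ b.toSubmodule
  lie_mem' {x y} hx hy := by
    obtain ⟨x1, hx1, x2, hx2, rfl⟩ := Submodule.mem_sup.1 hx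
    obtain ⟨y1, hy1, y2, hy2, rfl⟩ := Submodule.mem_sup.1 hy
    refine Submodule.mem_sup.2 ⟨⁅x1, y1⁆, a.lie_mem hx1 hy1, ⁅x2, y2⁆, b.lie_mem hx2 hy2, ?_⟩
    rw [add_lie, lie_add, lie_add, h x1 hx1 y2 hy2, ← lie_skew x2 y1, h y1 hy1 x2 hx2]
    simp

theorem mem_commutingSum {a b : LieSubalgebra ℂ (g T)} {h : ∀ x ∈ a, ∀ y ∈ b, ⁅x, y⁆ = 0}
    {z : g T} : z ∈ commutingSum a b h ↔ ∃ x ∈ a, ∃ y ∈ b, x + y = z :=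
  Submodule.mem_sup

/-- The sum of the Cartan subalgebra and a subalgebra stable under it. -/
def cartanSum (K : LieSubalgebra ℂ (g T)) (h : ∀ H ∈ cartan T, ∀ x ∈ K, ⁅H, x⁆ ∈ K) :
    LieSubalgebra ℂ (g T) where
  __ := (cartan T).toSubmodule ⊔ K.toSubmodule
  lie_mem' {x y} hx hy := by
    obtain ⟨x1, hx1, x2, hx2, rfl⟩ := Submodule.mem_sup.1 hx
    obtain ⟨y1, hy1, y2, hy2, rfl⟩ := Submodule.mem_sup.1 hy
    refine Submodule.mem_sup.2 ⟨0, zero_mem _, ⁅x1, y2⁆ + (⁅x2, y1⁆ + ⁅x2, y2⁆), ?_, ?_⟩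
    · refine add_mem (h _ hx1 _ hy2) (add_mem ?_ (K.lie_mem hx2 hy2))
      rw [← lie_skew]
      exact neg_mem (h _ hy1 _ hx2)
    · rw [add_lie, lie_add, lie_add, lie_cartan_cartan hx1 hy1]
      abel

theorem mem_cartanSum {K : LieSubalgebra ℂ (g T)} {h : ∀ H ∈ cartan T, ∀ x ∈ K, ⁅H, x⁆ ∈ K}
    {z : g T} : z ∈ cartanSum K h ↔ ∃ x ∈ cartan T, ∃ y ∈ K, x + y = z :=
  Submodule.mem_sup

/-- Since `h` is abelian and normalizes `K`, brackets in `h + K` lose their Cartan part. This bounds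
`[l(≺), l(≺)]` from above. -/
theorem lie_mem_of_mem_cartanSum {K : LieSubalgebra ℂ (g T)}
    {h : ∀ H ∈ cartan T, ∀ x ∈ K, ⁅H, x⁆ ∈ K} {x y : g T} (hx : x ∈ cartanSum K h)
    (hy : y ∈ cartanSum K h) : ⁅x, y⁆ ∈ K := by
  obtain ⟨x1, hx1, x2, hx2, rfl⟩ := mem_cartanSum.1 hx
  obtain ⟨y1, hy1, y2, hy2, rfl⟩ := mem_cartanSum.1 hy
  rw [add_lie, lie_add, lie_add, lie_cartan_cartan hx1 hy1, zero_add]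
  refine add_mem (h _ hx1 _ hy2) (add_mem ?_ (K.lie_mem hx2 hy2))
  rw [← lie_skew]
  exact neg_mem (h _ hy1 _ hx2)

/-- The other presentation of the root, by `(-b, -a)`, gives the same comparison because `≺` is
reversed by sign change. -/
theorem eps_sub_mem_rootsZero (hlin : Z2Linear r) {a b : Idx T ℕ+}
    (h : eps a - eps b ∈ roots T) (hab : b.toInt ∈ cls r a.toInt) (hr : IsStrictOrder ℤ r) :
    eps a - eps b ∈ rootsZero T r := by
  have key : ∀ a b : Idx T ℕ+, a ≠ b → b.toInt ∈ cls r a.toInt →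
      eps a - eps b ∉ rootsPos T r := by
    rintro a b hne hab ⟨_, c, d, h, hcd⟩
    have : r a.toInt b.toInt := by
      rcases eps_sub_eq_iff hne h with ⟨rfl, rfl⟩ | ⟨rfl, rfl⟩
      · exact hcd
      · rw [Idx.toInt_opp, Idx.toInt_opp] at hcd
        exact (hlin _ _).2 hcd
    exact notMem_cls_of_rel hr this (mem_cls_comm.1 hab)
  have hne := (ne_of_mem_roots h).1
  refine ⟨h, key a b hne hab, ?_⟩
  rw [neg_sub]
  exact key b a hne.symm (mem_cls_comm.1 hab)

theorem component_le_leviSS (hr : IsStrictOrder ℤ r) (hadm : Admissible r) (hlin : Z2Linear r)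
    (p : ℤ) : component T r p ≤ leviSS T r := by
  refine component_le fun a b ha hb hab hab' => ?_
  have hroot := eps_sub_mem_roots hab' (by rwa [Idx.opp_opp])
  have hzero := eps_sub_mem_rootsZero hlin hroot
    (mem_cls_trans hadm hb (mem_cls_comm.1 ha)) hr
  have hx := rootVec_mem_rootSpace a b.opp
  have hlevi : rootVec a b.opp.opp ∈ levi T r :=
    (le_sup_right : generated T (rootsZero T r) ≤ levi T r) (rootSpace_le_generated hzero hx)
  -- A root vector is a multiple of its bracket with an `H` on which the root does not vanish, hence
  -- lies in the derived algebra.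
  obtain ⟨H, hH⟩ : ∃ H, (eps a - eps b.opp) H ≠ 0 := by
    by_contra! h
    exact hroot.1 (LinearMap.ext h)
  have h1 : ⁅(H : g T), rootVec a b.opp.opp⁆ ∈ leviSS T r :=
    LieSubalgebra.subset_lieSpan
      ⟨_, (le_sup_left : cartan T ≤ levi T r) H.2, _, hlevi, rfl⟩
  rw [hx H] at h1
  have h2 := (leviSS T r).smul_mem ((eps a - eps b.opp) H)⁻¹ h1
  rwa [smul_smul, inv_mul_cancel₀ hH, one_smul, Idx.opp_opp] at h2

theorem isDirectSum_leviSS (hr : IsStrictOrder ℤ r) (hadm : Admissible r) (hlin : Z2Linear r) :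
    IsDirectSum T (leviSS T r) (component T r 0) (slPart T r) := by
  have hcomm : ∀ x ∈ component T r 0, ∀ y ∈ slPart T r, ⁅x, y⁆ = 0 := fun x hx y hy =>
    lie_component_slPart hadm hlin hx hy
  refine ⟨component_inf_slPart hadm hlin, le_antisymm (sup_le ?_ ?_) ?_, hcomm⟩
  · exact component_le_leviSS hr hadm hlin 0
  · exact (iSup₂_le fun p _ => component_le_leviSS hr hadm hlin p : slPart T r ≤ leviSS T r)
  · set K := commutingSum _ _ hcomm with hK
    have hst : ∀ H ∈ cartan T, ∀ x ∈ K, ⁅H, x⁆ ∈ K := by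
      intro H hH x hx
      obtain ⟨x1, hx1, x2, hx2, rfl⟩ := mem_commutingSum.1 hx
      rw [slPart_eq_generated] at hx2
      rw [lie_add]
      refine mem_commutingSum.2 ⟨_, lie_cartan_mem_generated hH hx1, _, ?_, rfl⟩
      rw [slPart_eq_generated]
      exact lie_cartan_mem_generated hH hx2
    -- Each root in `P^0` has both indices in one class, so its root space lies in `o([0])` or in
    -- `sl(≺)`.
    have hlevi : levi T r ≤ cartanSum K hst := by
      refine sup_le (fun x hx => mem_cartanSum.2 ⟨x, hx, 0, zero_mem _, add_zero _⟩) ?_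
      refine generated_le fun α hα x hx => mem_cartanSum.2 ⟨0, zero_mem _, x, ?_, zero_add _⟩
      obtain ⟨hroot, h1, h2⟩ := hα
      obtain ⟨a, b, rfl⟩ := exists_eq_eps_sub hroot
      have hba : b.toInt ∈ cls r a.toInt := by
        refine Or.inr ⟨fun h => h1 ⟨hroot, a, b, rfl, h⟩, fun h => h2 ⟨?_, b, a, ?_, h⟩⟩
        · rw [neg_sub]
          obtain ⟨h3, h4⟩ := ne_of_mem_roots hroot
          exact eps_sub_mem_roots h3.symm fun h5 => h4 (Idx.opp_eq_iff.1 h5.symm)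
        · rw [neg_sub]
      have hxc : x ∈ component T r a.toInt := LieSubalgebra.subset_lieSpan
        (Set.mem_biUnion (by exact ⟨hroot, a, b, rfl, mem_cls_self r _, hba⟩) hx)
      by_cases h0 : cls r a.toInt = cls r 0
      · refine mem_commutingSum.2 ⟨x, ?_, 0, zero_mem _, add_zero _⟩
        unfold component at hxc ⊢
        rwa [h0] at hxc
      · exact mem_commutingSum.2 ⟨0, zero_mem _, x, component_le_slPart h0 hxc, zero_add _⟩
    have : leviSS T r ≤ K := by
      refine LieSubalgebra.lieSpan_le.2 ?_
      rintro _ ⟨x, hx, y, hy, rfl⟩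
      exact lie_mem_of_mem_cartanSum (hlevi hx) (hlevi hy)
    exact this

theorem lie_rootVec_rootVec {a b : Idx T ℕ+} (h : a ≠ b) :
    ⁅rootVec a b, rootVec b.opp a.opp⁆ = rootVec a a.opp + rootVec b b.opp := by
  classical
  have e1 := rootVec_single a b b.opp
  have e2 := rootVec_single a b a.opp
  rw [if_pos rfl, if_neg fun h0 => h (Idx.opp_inj.1 h0).symm, sub_zero] at e1
  rw [if_pos rfl, if_neg fun h0 => h (Idx.opp_inj.1 h0), zero_sub] at e2
  conv_lhs => rw [rootVec.eq_1 b.opp, lie_wedge, e1, e2, wedge_neg_right, ← wedge_swap]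
  rfl

/-- With `h_a` denoting `rootVec a (-a)`, brackets of root vectors give `h_a + h_b` and, on
replacing `b` by `-b`, also `h_a - h_b`; half their sum is `h_a`. -/
theorem rootVec_opp_mem_component (hlin : Z2Linear r) {a b : Idx T ℕ+} (ha : a ∈ zeroIdx T r)
    (hb : b ∈ zeroIdx T r) (h : a ≠ b) (h' : a ≠ b.opp) :
    rootVec a a.opp ∈ component T r 0 := by
  have key : ∀ b, b ∈ zeroIdx T r → a ≠ b → a ≠ b.opp →
      rootVec a a.opp + rootVec b b.opp ∈ component T r 0 := fun b hb h h' => by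
    rw [← lie_rootVec_rootVec h]
    have h1 := (opp_mem_zeroIdx hlin).2 ha
    have h2 := (opp_mem_zeroIdx hlin).2 hb
    refine (component T r 0).lie_mem (rootVec_mem_component ha h2 h h')
      (rootVec_mem_component h2 ?_ ?_ ?_)
    · rwa [Idx.opp_opp]
    · exact fun h0 => h (Idx.opp_inj.1 h0).symm
    · rw [Idx.opp_opp]
      exact fun h0 => h' h0.symm
  have h1 := add_mem (key b hb h h')
    (key b.opp ((opp_mem_zeroIdx hlin).2 hb) h' (by rwa [Idx.opp_opp]))
  have h2 : rootVec b.opp b.opp.opp = - rootVec b b.opp := by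
    rw [Idx.opp_opp, rootVec, wedge_swap, rootVec]
  rw [h2, add_add_add_comm, add_neg_cancel, add_zero, ← two_smul ℂ] at h1
  have h3 := (component T r 0).smul_mem (1 / 2 : ℂ) h1
  rw [smul_smul] at h3
  norm_num at h3
  exact h3

theorem exists_eq_map_of_mem_zeroIdx {κ : Type} {e : κ ↪ ℕ+} (he : Set.range e = zeroPos r)
    (hlin : Z2Linear r) {a : Idx T ℕ+} (ha : a ∈ zeroIdx T r) : ∃ b : Idx T κ, b.map e = a := by
  cases a with
  | zero h => exact ⟨.zero h, rfl⟩
  | pos i =>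
    have : i ∈ zeroPos r := ha
    rw [← he] at this
    obtain ⟨k, rfl⟩ := this
    exact ⟨.pos k, rfl⟩
  | neg i =>
    have : i ∈ zeroPos r := (opp_mem_zeroIdx hlin).2 ha
    rw [← he] at this
    obtain ⟨k, rfl⟩ := this
    exact ⟨.neg k, rfl⟩

theorem map_mem_zeroIdx {κ : Type} {e : κ ↪ ℕ+} (he : Set.range e = zeroPos r)
    (hlin : Z2Linear r) (a : Idx T κ) : a.map e ∈ zeroIdx T r := by
  have key : ∀ i, Idx.pos (e i) ∈ zeroIdx T r := fun i => by
    have : e i ∈ zeroPos r := he ▸ Set.mem_range_self i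
    exact this
  cases a with
  | zero h => exact mem_cls_self r 0
  | pos i => exact key i
  | neg i => exact (opp_mem_zeroIdx hlin).1 (key i)

theorem spinType_eq (T : SpinType) : T = SpinType.B ∨ T = SpinType.D := by
  cases T <;> simp

theorem exists_idx_toInt {j : ℤ} (hj : j ≠ 0) :
    ∃ a : Idx T ℕ+, a.toInt = j := by
  rcases lt_or_gt_of_ne hj with h | h
  · exact ⟨.neg ⟨j.natAbs, by omega⟩, by simp only [Idx.toInt, PNat.mk_coe]; omega⟩
  · exact ⟨.pos ⟨j.natAbs, by omega⟩, by simp only [Idx.toInt, PNat.mk_coe]; omega⟩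

/-- Only the Cartan elements `rootVec a (-a)` are not root vectors, and a second index of `[0]`
produces them: `0` in type `B`, the one given by `hD` in type `D`. Without it the image would be
`o(2)`, a torus without roots, while the component would be zero. -/
theorem component_zero_eq_range {κ : Type} [LinearOrder κ] {e : κ ↪ ℕ+}
    (he : Set.range e = zeroPos r) (hlin : Z2Linear r)
    (hD : T = SpinType.D → ∀ i ∈ cls r 0, i ≠ 0 → ∃ j ∈ cls r 0, j ≠ 0 ∧ j ≠ i ∧ j ≠ -i) :
    component T r 0 = (o.map T e).range := by
  apply le_antisymm
  · refine component_le fun a b ha hb _ _ => ?_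
    obtain ⟨a, rfl⟩ := exists_eq_map_of_mem_zeroIdx he hlin ha
    obtain ⟨b, rfl⟩ := exists_eq_map_of_mem_zeroIdx he hlin ((opp_mem_zeroIdx hlin).1 hb)
    exact ⟨rootVec a b, map_rootVec e a b⟩
  · rintro _ ⟨X, rfl⟩
    refine mem_of_rootVec_mem ((component T r 0).toSubmodule.comap (o.map T e : o T κ →ₗ[ℂ] g T))
      (fun a b => ?_) X
    change o.map T e (rootVec a b) ∈ component T r 0
    rw [map_rootVec]
    have ha := map_mem_zeroIdx he hlin a
    have hb := map_mem_zeroIdx he hlin b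
    generalize a.map e = a at *
    generalize b.map e = b at *
    by_cases h1 : a = b
    · rw [h1, rootVec, wedge_self]
      exact zero_mem _
    by_cases h2 : b = a.opp
    · subst h2
      have hz : a.toInt ≠ 0 := by
        intro h0
        apply h1
        apply Idx.toInt_injective
        rw [Idx.toInt_opp, h0, neg_zero]
      obtain ⟨c, hc, hc1, hc2⟩ : ∃ c ∈ zeroIdx T r, a ≠ c ∧ a ≠ c.opp := by
        rcases spinType_eq T with hT | hT
        · subst hT
          refine ⟨.zero rfl, mem_cls_self r 0, ?_, ?_⟩ <;> (rintro rfl; exact hz rfl)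
        · obtain ⟨j, hj, hj0, hj1, hj2⟩ := hD hT _ ha hz
          obtain ⟨c, rfl⟩ := exists_idx_toInt (T := T) hj0
          refine ⟨c, hj, ?_, ?_⟩
          · rintro rfl
            exact hj1 rfl
          · rintro rfl
            rw [Idx.toInt_opp, neg_neg] at hj2
            exact hj2 rfl
      exact rootVec_opp_mem_component hlin ha hc hc1 hc2
    · exact rootVec_mem_component ha ((opp_mem_zeroIdx hlin).2 hb) h1
        fun h => h2 (by rw [h, Idx.opp_opp])

end Structure

/-! ### Clifford generators as monomial operators. -/

section FockSpace

variable {T : SpinType} {ι : Type} {A : Set ι}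

/-- The coefficient at a basis vector as a linear form. -/
def Fock.coeffₗ (T : SpinType) (A : Set ι) (F : Finset ι) : Fock T A →ₗ[ℂ] ℂ :=
  (Finsupp.lapply F : (Finset ι →₀ ℂ) →ₗ[ℂ] ℂ)

theorem Fock.coeffₗ_apply (F : Finset ι) (m : Fock T A) : Fock.coeffₗ T A F m = m.coeff F := rfl

theorem Fock.coeff_vec [DecidableEq ι] (F G : Finset ι) :
    (Fock.vec T A F).coeff G = if F = G then 1 else 0 :=
  Finsupp.single_apply

theorem Fock.coeff_ext {m n : Fock T A} (h : ∀ F, m.coeff F = n.coeff F) : m = n :=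
  Finsupp.ext (M := ℂ) h

theorem Fock.form_ext {f g : Fock T A →ₗ[ℂ] ℂ}
    (h : ∀ F, f (Fock.vec T A F) = g (Fock.vec T A F)) : f = g :=
  Finsupp.lhom_ext' (M := ℂ) fun F => LinearMap.ext_ring (h F)

/-- The condition that `gamma T A a` does not kill the basis vector indexed by `F`. -/
def Alive (A : Set ι) (F : Finset ι) : Idx T ι → Prop
  | .pos i => i ∉ symmDiff A (F : Set ι)
  | .neg i => i ∈ symmDiff A (F : Set ι)
  | .zero _ => True

theorem alive_or_alive_opp (F : Finset ι) (a : Idx T ι) : Alive A F a ∨ Alive A F a.opp := by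
  cases a with
  | pos i => exact (em _).symm
  | neg i => exact em _
  | zero _ => exact Or.inl trivial

variable [LinearOrder ι]

/-- The label of the image of the basis vector indexed by `F` under `gamma T A a`. -/
def target (F : Finset ι) : Idx T ι → Finset ι
  | .pos i => toggle F i
  | .neg i => toggle F i
  | .zero _ => F

/-- The scalar by which `gamma T A a` acts on a basis vector that it does not kill. -/
def scalar (F : Finset ι) : Idx T ι → ℂ
  | .pos i => sgn F i
  | .neg i => sgn F i
  | .zero _ => (((Real.sqrt 2)⁻¹ : ℝ) : ℂ) * (-1 : ℂ) ^ F.card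

theorem sgn_ne_zero (F : Finset ι) (i : ι) : sgn F i ≠ 0 :=
  left_ne_zero_of_mul_eq_one (sgn_mul_self F i)

theorem scalar_ne_zero (F : Finset ι) (a : Idx T ι) : scalar F a ≠ 0 := by
  cases a with
  | pos i => exact sgn_ne_zero F i
  | neg i => exact sgn_ne_zero F i
  | zero _ => simp [scalar]

open Classical in
theorem gamma_vec (a : Idx T ι) (F : Finset ι) :
    gamma T A a (Fock.vec T A F) =
      if Alive A F a then scalar F a • Fock.vec T A (target F a) else 0 := by
  cases a with
  | pos i => by_cases h : i ∈ symmDiff A (F : Set ι) <;>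
      simp [gamma, Fock.lift_vec, Alive, scalar, target, h]
  | neg i => by_cases h : i ∈ symmDiff A (F : Set ι) <;>
      simp [gamma, Fock.lift_vec, Alive, scalar, target, h]
  | zero _ => simp [gamma, Fock.lift_vec, Alive, scalar, target, smul_smul]

theorem target_target (F : Finset ι) (a : Idx T ι) : target (target F a) a = F := by
  cases a with
  | pos i => exact toggle_toggle F i
  | neg i => exact toggle_toggle F i
  | zero _ => rfl

theorem target_inj {F G : Finset ι} {a : Idx T ι} : target F a = target G a ↔ F = G :=
  ⟨fun h => by rw [← target_target F a, h, target_target], fun h => h ▸ rfl⟩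

open Classical in
-- The relabelling `target · a` is an involution, so only the label `F` contributes to this
-- coefficient: there is no cancellation.
theorem coeff_gamma (a : Idx T ι) (F : Finset ι) (m : Fock T A) :
    (gamma T A a m).coeff (target F a) = if Alive A F a then scalar F a * m.coeff F else 0 := by
  have h : Fock.coeffₗ T A (target F a) ∘ₗ gamma T A a =
      (if Alive A F a then scalar F a else 0) • Fock.coeffₗ T A F := by
    refine Fock.form_ext fun G => ?_
    rw [LinearMap.comp_apply, gamma_vec, LinearMap.smul_apply, Fock.coeffₗ_apply F,
      Fock.coeff_vec]
    by_cases hG : G = F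
    · subst hG
      by_cases h : Alive A G a
      · rw [if_pos h, if_pos h, map_smul, Fock.coeffₗ_apply, Fock.coeff_vec, if_pos rfl]
        simp
      · rw [if_neg h, if_neg h, map_zero, zero_smul]
    · rw [if_neg hG, smul_zero]
      split_ifs
      · rw [map_smul, Fock.coeffₗ_apply, Fock.coeff_vec, if_neg fun h => hG (target_inj.1 h),
          smul_zero]
      · exact map_zero _
  have h1 := LinearMap.congr_fun h m
  rw [LinearMap.comp_apply, LinearMap.smul_apply, Fock.coeffₗ_apply, Fock.coeffₗ_apply] at h1
  rw [h1, ite_smul, zero_smul, smul_eq_mul]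

theorem gamma_eq_zero {a : Idx T ι} {m : Fock T A}
    (h : ∀ F, m.coeff F ≠ 0 → ¬ Alive A F a) : gamma T A a m = 0 := by
  classical
  refine Fock.coeff_ext fun F => ?_
  rw [← target_target F a, coeff_gamma]
  split_ifs with h1
  · by_cases h2 : m.coeff (target F a) = 0
    · rw [h2, mul_zero]
      rfl
    · exact absurd h1 (h _ h2)
  · rfl

theorem alive_target {F : Finset ι} {a b : Idx T ι} (h : a ≠ b) (h' : a ≠ b.opp) :
    Alive A (target F b) a ↔ Alive A F a := by
  cases a <;> cases b <;> simp_all [Alive, target, mem_toggle, Idx.opp]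

/-- As `b ≠ ±a`, applying `γ_b` does not affect whether `γ_a` kills the label. The coefficient of
`m` at `F` therefore survives both operators. -/
theorem gamma_gamma_ne_zero {F : Finset ι} {a b : Idx T ι} (h : a ≠ b) (h' : a ≠ b.opp)
    {m : Fock T A} (hF : m.coeff F ≠ 0) (ha : Alive A F a) (hb : Alive A F b) :
    gamma T A a (gamma T A b m) ≠ 0 := by
  classical
  intro h0
  have h1 := coeff_gamma a (target F b) (gamma T A b m)
  rw [h0, if_pos ((alive_target h h').2 ha), coeff_gamma, if_pos hb] at h1
  exact mul_ne_zero (scalar_ne_zero _ _) (mul_ne_zero (scalar_ne_zero _ _) hF) h1.symm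

end FockSpace

/-! ### The `u(≺)`-invariants are the vectors supported on compatible labels. -/

section Invariants

variable {T : SpinType} {r : ℤ → ℤ → Prop} {A : Set ℕ+}

/-- The annihilator of a vector of the Fock space. -/
def annihilator (v : Fock T A) : LieSubalgebra ℂ (g T) where
  carrier := {x | rho T A x v = 0}
  zero_mem' := by
    change ⁅(0 : g T), v⁆ = 0
    exact zero_lie v
  add_mem' {x y} hx hy := by
    change rho T A (x + y) v = 0
    rw [rho_add, LinearMap.add_apply, hx, hy, add_zero]
  smul_mem' c x hx := by
    change rho T A (c • x) v = 0
    rw [rho_smul, LinearMap.smul_apply, hx, smul_zero]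
  lie_mem' {x y} hx hy := by
    change rho T A ⁅x, y⁆ v = 0
    rw [rho_lie, LinearMap.sub_apply, Module.End.mul_apply, Module.End.mul_apply, hx, hy, map_zero,
      map_zero, sub_zero]

theorem mem_annihilator {v : Fock T A} {x : g T} : x ∈ annihilator v ↔ rho T A x v = 0 := Iff.rfl

theorem rootVec_mem_annihilator {v : Fock T A} {a b : Idx T ℕ+} (h : a ≠ b.opp) :
    rootVec a b ∈ annihilator v ↔ gamma T A a (gamma T A b v) = 0 := by
  rw [mem_annihilator, rho_rootVec fun h' => h (by rw [h', Idx.opp_opp]), Module.End.mul_apply]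

/-- The annihilator of a vector is a Lie subalgebra, so invariance need only be tested on the
generators of `u(≺)`. -/
theorem mem_invariants_iff {m : Spinor T A} : m ∈ invariants T r (Spinor T A) ↔
    ∀ a b : Idx T ℕ+, r a.toInt b.opp.toInt → a ≠ b → a ≠ b.opp →
      gamma T A a (gamma T A b (m : Fock T A)) = 0 := by
  constructor
  · intro h a b hab h1 h2
    have h3 := congrArg Subtype.val (h _ (rootVec_mem_nilrad hab h1 h2))
    exact (rootVec_mem_annihilator h2).1 h3
  · intro h x hx
    have : nilrad T r ≤ annihilator (m : Fock T A) := nilrad_le fun a b hab h1 h2 =>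
      (rootVec_mem_annihilator h2).2 (h a b hab h1 h2)
    exact Subtype.ext (this hx)

/-- Compatible labels are the vacuum vectors for the generators `γ_a` with `a ≺ 0`: such a generator
could only add a `k ≺ 0` that is missing or remove a `k ≻ 0` that is present. -/
theorem compatible_iff (hr : IsStrictOrder ℤ r) (hlin : Z2Linear r) {F : Finset ℕ+} :
    Compatible r (symmDiff A (F : Set ℕ+)) ↔
      ∀ a : Idx T ℕ+, r a.toInt 0 → ¬ Alive A F a := by
  constructor
  · rintro ⟨h1, h2⟩ a ha hF
    cases a with
    | zero _ => exact hr.irrefl _ ha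
    | pos i =>
      rcases h2 i hF with h | h
      · exact hr.irrefl _ (hr.trans _ _ _ ha h)
      · exact notMem_cls_of_rel hr ha h
    | neg i =>
      have ha' := (rel_zero_neg hlin).1 ha
      rcases h1 i hF with h | h
      · exact hr.irrefl _ (hr.trans _ _ _ h ha')
      · exact notMem_cls_of_rel hr ha' (mem_cls_comm.1 h)
  · intro h
    constructor
    · intro k hk
      rcases rel_trichotomy (r := r) k 0 with h1 | h1 | h1
      · exact Or.inl h1
      · exact absurd hk (h (.neg k) ((rel_zero_neg hlin).2 h1))
      · exact Or.inr h1
    · intro k hk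
      rcases rel_trichotomy (r := r) k 0 with h1 | h1 | h1
      · exact absurd hk (h (.pos k) h1)
      · exact Or.inl h1
      · exact Or.inr h1

theorem gamma_eq_zero_of_compatible (hr : IsStrictOrder ℤ r) (hlin : Z2Linear r) {m : Fock T A}
    (hm : ∀ F, m.coeff F ≠ 0 → Compatible r (symmDiff A (F : Set ℕ+))) {a : Idx T ℕ+}
    (ha : r a.toInt 0) : gamma T A a m = 0 :=
  gamma_eq_zero fun F hF => (compatible_iff hr hlin).1 (hm F hF) a ha

theorem gamma_gamma_eq_zero_of_compatible (hr : IsStrictOrder ℤ r) (hlin : Z2Linear r)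
    {m : Fock T A} (hm : ∀ F, m.coeff F ≠ 0 → Compatible r (symmDiff A (F : Set ℕ+)))
    {a b : Idx T ℕ+} (h : r a.toInt 0 ∨ r b.toInt 0) (hab : a ≠ b.opp) :
    gamma T A a (gamma T A b m) = 0 := by
  rcases h with h | h
  · rw [← Module.End.mul_apply, gamma_anticomm fun h' => hab (by rw [h', Idx.opp_opp]),
      LinearMap.neg_apply, Module.End.mul_apply, gamma_eq_zero_of_compatible hr hlin hm h, map_zero,
      neg_zero]
  · rw [gamma_eq_zero_of_compatible hr hlin hm h, map_zero]

theorem mem_invariants_of_compatible (hr : IsStrictOrder ℤ r) (hadm : Admissible r)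
    (hlin : Z2Linear r) {m : Spinor T A}
    (hm : ∀ F, (m : Fock T A).coeff F ≠ 0 → Compatible r (symmDiff A (F : Set ℕ+))) :
    m ∈ invariants T r (Spinor T A) := by
  refine mem_invariants_iff.2 fun a b hab _ h2 => gamma_gamma_eq_zero_of_compatible hr hlin hm ?_ h2
  rcases rel_trichotomy (r := r) b.opp.toInt 0 with h | h | h
  · exact Or.inl (hr.trans _ _ _ hab h)
  · rw [Idx.toInt_opp] at h
    right
    rwa [← rel_zero_neg hlin, neg_neg] at h
  · exact Or.inl (rel_of_rel_of_mem_cls hr hadm hab (mem_cls_comm.1 h))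

/-- When `[0] = {0}` a compatible set is determined by `≺`. Wherever `A ∆ F` deviates from it, one
of `e_l`, `e_{-l}` is `≺ 0` and corrects the deviation. -/
theorem exists_alive_of_misplaced (hlin : Z2Linear r)
    (h0 : cls r 0 = {0}) {A' : Set ℕ+} (hA' : Compatible r A') {F : Finset ℕ+} {l : ℕ+}
    (hl : l ∈ symmDiff A' (symmDiff A (F : Set ℕ+))) :
    ∃ b : Idx T ℕ+, r b.toInt 0 ∧ Alive A F b ∧ (b = .pos l ∨ b = .neg l) := by
  have hl0 : ((l : ℕ) : ℤ) ∉ cls r 0 := by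
    rw [h0]
    have := l.pos
    simp
  rcases hl with ⟨h1, h2⟩ | ⟨h1, h2⟩
  · exact ⟨.pos l, (hA'.1 l h1).resolve_right hl0, h2, Or.inl rfl⟩
  · exact ⟨.neg l, (rel_zero_neg hlin).2 ((hA'.2 l h2).resolve_right hl0), h1, Or.inr rfl⟩

theorem even_card_symmDiff {F G : Finset ℕ+} (hF : Even F.card) (hG : Even G.card) :
    Even (symmDiff F G).card := by
  have h := neg_one_pow_card_symmDiff F G
  rw [hF.neg_one_pow, hG.neg_one_pow, one_mul] at h
  by_contra ho
  rw [Nat.not_even_iff_odd] at ho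
  rw [ho.neg_one_pow] at h
  norm_num at h

/-- If a label with nonzero coefficient is not killed by some `γ_a` with `a ≺ 0`, a partner `b` as
in the `suffices` makes `γ_a γ_b` a generator of `u(≺)` that does not kill the vector. -/
theorem compatible_of_mem_invariants (hr : IsStrictOrder ℤ r) (hadm : Admissible r)
    (hlin : Z2Linear r)
    (hcomp : T = SpinType.D → cls r 0 = {0} → ∃ A' : Set ℕ+, Compatible r A' ∧ Sim T A' A)
    {m : Spinor T A} (hm : m ∈ invariants T r (Spinor T A)) {F : Finset ℕ+}
    (hF : (m : Fock T A).coeff F ≠ 0) : Compatible r (symmDiff A (F : Set ℕ+)) := by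
  refine (compatible_iff (T := T) hr hlin).2 fun a ha hFa => ?_
  suffices h : ∃ b : Idx T ℕ+, Alive A F b ∧ r a.toInt b.opp.toInt ∧ a ≠ b ∧ a ≠ b.opp by
    obtain ⟨b, hb, hab, h1, h2⟩ := h
    exact gamma_gamma_ne_zero h1 h2 hF hFa hb (mem_invariants_iff.1 hm a b hab h1 h2)
  -- Any `b` in `[0]` serves as partner, since `-b` is also in `[0]` and hence `a ≺ -b`.
  have key : ∀ b ∈ zeroIdx T r, Alive A F b →
      ∃ b : Idx T ℕ+, Alive A F b ∧ r a.toInt b.opp.toInt ∧ a ≠ b ∧ a ≠ b.opp := by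
    intro b hb hFb
    have hb' := (opp_mem_zeroIdx hlin).2 hb
    refine ⟨b, hFb, rel_of_rel_of_mem_cls hr hadm ha hb', ?_, ?_⟩
    · rintro rfl
      exact notMem_cls_of_rel hr ha hb
    · rintro rfl
      exact notMem_cls_of_rel hr ha hb'
  rcases spinType_eq T with hT | hT
  · exact key (.zero hT) (mem_cls_self r 0) trivial
  by_cases h0 : cls r 0 = {0}
  · obtain ⟨A', hA', hfin, heven⟩ := hcomp hT h0
    -- The set of positions where `A ∆ F` deviates from the compatible set. It has even size and
    -- contains the index of `a`, so it contains another one, which yields a partner `b ≺ 0`.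
    set D := symmDiff hfin.toFinset F with hD
    have hD' : (D : Set ℕ+) = symmDiff A' (symmDiff A (F : Set ℕ+)) := by
      rw [hD, Finset.coe_symmDiff, Set.Finite.coe_toFinset, symmDiff_assoc]
    have hDeven : Even D.card := by
      refine even_card_symmDiff ?_ (m.2 hT F hF)
      rw [← Set.ncard_eq_toFinset_card _ hfin]
      exact heven hT
    have hk : ∃ k ∈ D, a = .pos k ∨ a = .neg k := by
      simp only [← Finset.mem_coe, hD']
      cases a with
      | zero h => exact absurd (h.symm.trans hT) (by simp)
      | pos k =>
        refine ⟨k, Or.inl ⟨?_, hFa⟩, Or.inl rfl⟩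
        by_contra hk
        rcases hA'.2 k hk with h | h
        · exact hr.irrefl _ (hr.trans _ _ _ ha h)
        · exact notMem_cls_of_rel hr ha h
      | neg k =>
        refine ⟨k, Or.inr ⟨hFa, ?_⟩, Or.inr rfl⟩
        intro hk
        have ha' := (rel_zero_neg hlin).1 ha
        rcases hA'.1 k hk with h | h
        · exact hr.irrefl _ (hr.trans _ _ _ h ha')
        · exact notMem_cls_of_rel hr ha' (mem_cls_comm.1 h)
    obtain ⟨k, hk, hak⟩ := hk
    have hcard : 1 < D.card := by
      have := Finset.card_pos.2 ⟨k, hk⟩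
      obtain ⟨n, hn⟩ := hDeven
      omega
    obtain ⟨l, hl, hlk⟩ := Finset.exists_mem_ne hcard k
    rw [← Finset.mem_coe, hD'] at hl
    obtain ⟨b, hb, hFb, hbl⟩ := exists_alive_of_misplaced (T := T) hlin h0 hA' hl
    refine ⟨b, hFb, hr.trans _ _ _ ha ?_, ?_, ?_⟩
    · rw [Idx.toInt_opp, ← rel_zero_neg hlin, neg_neg]
      exact hb
    · rcases hak with rfl | rfl <;> rcases hbl with rfl | rfl <;> simp [Ne.symm hlk]
    · rcases hak with rfl | rfl <;> rcases hbl with rfl | rfl <;> simp [Idx.opp, Ne.symm hlk]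
  · obtain ⟨j, hj, hj0⟩ : ∃ j ∈ cls r 0, j ≠ 0 := by
      by_contra! h
      exact h0 (Set.eq_singleton_iff_unique_mem.2 ⟨mem_cls_self r 0, h⟩)
    obtain ⟨c, rfl⟩ := exists_idx_toInt (T := T) hj0
    -- At any index of `[0]`, one of the two opposite generators does not kill the label.
    rcases alive_or_alive_opp (A := A) F c with h | h
    · exact key c hj h
    · exact key _ ((opp_mem_zeroIdx hlin).2 hj) h

theorem exists_coeff_ne_zero {ι : Type} [LinearOrder ι] {A : Set ι} {m : Fock T A} (h : m ≠ 0) :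
    ∃ F, m.coeff F ≠ 0 := by
  by_contra! h'
  exact h (Fock.coeff_ext h')

theorem sim_symmDiff {F : Finset ℕ+} (hF : T = SpinType.D → Even F.card) :
    Sim T (symmDiff A (F : Set ℕ+)) A := by
  have h : symmDiff (symmDiff A (F : Set ℕ+)) A = F := by
    rw [symmDiff_comm, symmDiff_symmDiff_cancel_left]
  rw [Sim, h]
  refine ⟨F.finite_toSet, fun hT => ?_⟩
  rw [Set.ncard_coe_finset]
  exact hF hT

theorem exists_compatible (hr : IsStrictOrder ℤ r) (hadm : Admissible r) (hlin : Z2Linear r)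
    (hcomp : T = SpinType.D → cls r 0 = {0} → ∃ A' : Set ℕ+, Compatible r A' ∧ Sim T A' A)
    (hinv : invariants T r (Spinor T A) ≠ ⊥) :
    ∃ A' : Set ℕ+, Compatible r A' ∧ Sim T A' A := by
  obtain ⟨m, hm, h0⟩ := (Submodule.ne_bot_iff _).1 hinv
  obtain ⟨F, hF⟩ := exists_coeff_ne_zero fun h => h0 (Subtype.ext h)
  exact ⟨_, compatible_of_mem_invariants hr hadm hlin hcomp hm hF,
    sim_symmDiff fun hT => m.2 hT F hF⟩

/-- A class `[p] ≠ [0]` lies entirely below or entirely above `0`. For a root vector `rootVec a b`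
of `g[p]` this gives `a ≺ 0` in the first case and `b ≺ 0` in the second, and that factor kills the
vector. -/
theorem slPart_lie_eq_zero (hr : IsStrictOrder ℤ r) (hadm : Admissible r) (hlin : Z2Linear r)
    {m : Spinor T A}
    (hm : ∀ F, (m : Fock T A).coeff F ≠ 0 → Compatible r (symmDiff A (F : Set ℕ+)))
    {Y : g T} (hY : Y ∈ slPart T r) : ⁅Y, m⁆ = 0 := by
  have : slPart T r ≤ annihilator (m : Fock T A) := by
    refine slPart_le fun p hp a b ha hb _ h2 => (rootVec_mem_annihilator h2).2
      (gamma_gamma_eq_zero_of_compatible hr hlin hm ?_ h2)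
    rcases rel_trichotomy (r := r) p 0 with h | h | h
    · exact Or.inl (rel_of_mem_cls_of_rel hr hadm h ha)
    · right
      have h1 := rel_of_rel_of_mem_cls hr hadm h hb
      rwa [Idx.toInt_opp, ← rel_zero_neg hlin, neg_neg] at h1
    · exact absurd (cls_eq hadm h) hp
  exact Subtype.ext (this hY)

end Invariants

/-! ### Aligned modules have nonzero invariants. -/

section Aligned

open TensorProduct

variable {T : SpinType} {r : ℤ → ℤ → Prop}

/-- The images of the `1 ⊗ s` are `u(≺)`-invariant and generate `M` over `U(g)`. Without nonzero
invariants `M` would be zero, which is not irreducible. -/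
theorem invariants_ne_bot_of_isAligned (M : Type) [AddCommGroup M] [Module ℂ M]
    [LieRingModule (g T) M] [LieModule ℂ (g T) M] (h : IsAligned T r M) :
    invariants T r M ≠ ⊥ := by
  obtain ⟨hirr, S, _, _, _, _, hS, -, -, -, f, hsurj, hf⟩ := h
  intro hbot
  let U := UniversalEnvelopingAlgebra ℂ (g T)
  let mk : U ⊗[ℂ] S → Verma T (parabolic T r) S := Submodule.Quotient.mk
  have hgen : ∀ s : S, f (mk (1 ⊗ₜ s)) = 0 := by
    intro s
    have : f (mk (1 ⊗ₜ s)) ∈ invariants T r M := by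
      intro x hx
      have hle : nilrad T r ≤ parabolic T r := by
        refine generated_le fun α hα y hy => ?_
        exact (le_sup_right : _ ≤ parabolic T r) (rootSpace_le_generated (Or.inr hα) hy)
      rw [← hf]
      have h1 : mk ((1 * UniversalEnvelopingAlgebra.ι ℂ x) ⊗ₜ[ℂ] s) -
          mk ((1 : U) ⊗ₜ[ℂ] ⁅(⟨x, hle hx⟩ : parabolic T r), s⁆) = 0 :=
        (Submodule.Quotient.mk_eq_zero _).2 (Submodule.subset_span ⟨1, ⟨x, hle hx⟩, s, rfl⟩)
      rw [hS _ hx, TensorProduct.tmul_zero] at h1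
      have h2 : UniversalEnvelopingAlgebra.ι ℂ x • mk ((1 : U) ⊗ₜ[ℂ] s) =
          mk ((1 * UniversalEnvelopingAlgebra.ι ℂ x) ⊗ₜ[ℂ] s) := by
        rw [one_mul]
        change mk (UniversalEnvelopingAlgebra.ι ℂ x • ((1 : U) ⊗ₜ[ℂ] s)) = _
        rw [TensorProduct.smul_tmul', smul_eq_mul, mul_one]
      have h3 : mk 0 = 0 := rfl
      rw [h3, sub_zero] at h1
      rw [h2, h1, map_zero]
    rwa [hbot, Submodule.mem_bot] at this
  -- Equivariance of `f` is given only for elements of `g`; it is propagated along the presentation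
  -- of `U(g)` as a quotient of the tensor algebra.
  have hU : ∀ u : U, ∀ t, f t = 0 → f (u • t) = 0 := by
    intro u
    have hmk : Function.Surjective (UniversalEnvelopingAlgebra.mkAlgHom ℂ (g T)) :=
      RingCon.mkₐ_surjective _
    obtain ⟨u, rfl⟩ := hmk u
    induction u using TensorAlgebra.induction with
    | algebraMap c =>
      intro t ht
      rw [AlgHom.commutes, algebraMap_smul, map_smul, ht, smul_zero]
    | ι x =>
      intro t ht
      exact (hf x t).trans (by rw [ht, lie_zero])
    | mul u v hu hv =>
      intro t ht
      rw [map_mul, mul_smul]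
      exact hu _ (hv _ ht)
    | add u v hu hv =>
      intro t ht
      rw [map_add, add_smul, map_add, hu _ ht, hv _ ht, add_zero]
  have hzero : ∀ t : U ⊗[ℂ] S, f (mk t) = 0 := by
    intro t
    induction t using TensorProduct.induction_on with
    | zero => exact map_zero f
    | tmul u s =>
      have h2 : u • mk ((1 : U) ⊗ₜ[ℂ] s) = mk (u ⊗ₜ[ℂ] s) := by
        change mk (u • ((1 : U) ⊗ₜ[ℂ] s)) = _
        rw [TensorProduct.smul_tmul', smul_eq_mul, mul_one]
      rw [← h2]
      exact hU u _ (hgen s)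
    | add x y hx hy =>
      change f (mk x + mk y) = 0
      rw [map_add, hx, hy, add_zero]
  have hnon : Nontrivial M := (LieModule.nontrivial_of_isIrreducible ℂ (g T) M)
  obtain ⟨x, hx⟩ := exists_ne (0 : M)
  obtain ⟨t, rfl⟩ := hsurj x
  obtain ⟨t, rfl⟩ := Submodule.Quotient.mk_surjective _ t
  exact hx (hzero t)

end Aligned

/-! ### Embedding of the Fock space over `J`. -/

section Shift

variable {T : SpinType} {κ : Type} [LinearOrder κ] (e : κ ↪o ℕ+) (A : Set ℕ+) (F₀ : Finset ℕ+)

/-- The label in the Fock space over `ℤ_{>0}` of the image of a label of the Fock space over `κ`. -/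
def shift (G : Finset κ) : Finset ℕ+ := symmDiff F₀ (G.map e.toEmbedding)

/-- The sign attached to the image of a basis vector. -/
def shiftSign (G : Finset κ) : ℂ := ∏ i ∈ G, (-1) ^ F₀.card * sgn F₀ (e i)

/-- The embedding of Fock spaces that maps the basis vector of weight `ω_{e⁻¹(A ∆ F₀) ∆ G}` to a
multiple of the one of weight `ω_{A ∆ F₀ ∆ e(G)}`. -/
def fockMap (T : SpinType) :
    Fock T (e ⁻¹' (symmDiff A (F₀ : Set ℕ+))) →ₗ[ℂ] Fock T A :=
  (Finsupp.linearCombination ℂ fun G => shiftSign e F₀ G • Fock.vec T A (shift e F₀ G) :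
    (Finset κ →₀ ℂ) →ₗ[ℂ] Fock T A)

variable {e A F₀}

theorem fockMap_vec (G : Finset κ) : fockMap e A F₀ T (Fock.vec T _ G) =
    shiftSign e F₀ G • Fock.vec T A (shift e F₀ G) := by
  unfold fockMap Fock.vec
  erw [Finsupp.linearCombination_single]
  rw [one_smul]

theorem shift_injective : Function.Injective (shift e F₀) := fun _ _ h =>
  Finset.map_injective _ (symmDiff_right_injective _ h)

theorem neg_one_pow_mul_self (n : ℕ) : (-1 : ℂ) ^ n * (-1) ^ n = 1 := by
  rw [← mul_pow]; simp

theorem shiftSign_factor_mul_self (i : κ) :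
    ((-1 : ℂ) ^ F₀.card * sgn F₀ (e i)) * ((-1) ^ F₀.card * sgn F₀ (e i)) = 1 := by
  rw [mul_mul_mul_comm, neg_one_pow_mul_self, sgn_mul_self, one_mul]

theorem shiftSign_mul_self (G : Finset κ) : shiftSign e F₀ G * shiftSign e F₀ G = 1 := by
  rw [shiftSign, ← Finset.prod_mul_distrib]
  exact Finset.prod_eq_one fun i _ => shiftSign_factor_mul_self i

theorem shiftSign_toggle (G : Finset κ) (i : κ) :
    shiftSign e F₀ (toggle G i) = shiftSign e F₀ G * ((-1) ^ F₀.card * sgn F₀ (e i)) := by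
  have key : ∀ H : Finset κ, i ∉ H → toggle H i = insert i H := by
    intro H hi
    ext j
    simp only [toggle, Finset.mem_symmDiff, Finset.mem_singleton, Finset.mem_insert]
    by_cases h : j = i
    · subst h; simp [hi]
    · simp [h]
  by_cases hi : i ∈ G
  · have hi' : i ∉ toggle G i := by simp [toggle, Finset.mem_symmDiff, hi]
    have h := key _ hi'
    rw [toggle_toggle] at h
    conv_rhs => rw [h, shiftSign, Finset.prod_insert hi', mul_comm, ← mul_assoc,
      shiftSign_factor_mul_self, one_mul]
    rfl
  · rw [key G hi, shiftSign, Finset.prod_insert hi, mul_comm]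
    rfl

theorem sgn_symmDiff {ι : Type} [LinearOrder ι] (F G : Finset ι) (i : ι) :
    sgn (symmDiff F G) i = sgn F i * sgn G i := by
  have h : (symmDiff F G).filter (· < i) = symmDiff (F.filter (· < i)) (G.filter (· < i)) := by
    ext k
    simp only [Finset.mem_filter, Finset.mem_symmDiff]
    tauto
  rw [sgn, h, neg_one_pow_card_symmDiff, sgn, sgn]

/-- The sign counts smaller elements, so this uses that `e` preserves the order. -/
theorem sgn_shift (G : Finset κ) (i : κ) : sgn (shift e F₀ G) (e i) = sgn F₀ (e i) * sgn G i := by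
  rw [shift, sgn_symmDiff]
  congr 1
  rw [sgn, Finset.filter_map, Finset.card_map, sgn]
  congr 3
  ext j
  simp

theorem toggle_shift (G : Finset κ) (i : κ) :
    toggle (shift e F₀ G) (e i) = shift e F₀ (toggle G i) := by
  have h : (toggle G i).map e.toEmbedding = toggle (G.map e.toEmbedding) (e i) := by
    ext k
    simp only [toggle, Finset.mem_map, Finset.mem_symmDiff, Finset.mem_singleton]
    constructor
    · rintro ⟨j, hj, rfl⟩
      simpa using hj
    · rintro (⟨⟨j, hj, rfl⟩, h⟩ | ⟨rfl, h⟩)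
      · exact ⟨j, by simpa [hj] using h, rfl⟩
      · exact ⟨i, by simpa using h, rfl⟩
  rw [shift, shift, h, toggle, toggle, symmDiff_assoc]

theorem target_shift (G : Finset κ) (a : Idx T κ) :
    target (shift e F₀ G) (a.map e) = shift e F₀ (target G a) := by
  cases a with
  | pos i => exact toggle_shift G i
  | neg i => exact toggle_shift G i
  | zero _ => rfl

theorem alive_shift (G : Finset κ) (a : Idx T κ) :
    Alive A (shift e F₀ G) (a.map e) ↔ Alive (e ⁻¹' (symmDiff A (F₀ : Set ℕ+))) G a := by
  have key : ∀ i, e i ∈ symmDiff A (shift e F₀ G : Set ℕ+) ↔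
      i ∈ symmDiff (e ⁻¹' (symmDiff A (F₀ : Set ℕ+))) (G : Set κ) := fun i => by
    simp only [shift, Set.mem_symmDiff, Finset.coe_symmDiff, Set.mem_preimage, Finset.mem_coe,
      Finset.mem_map, RelEmbedding.coe_toEmbedding, EmbeddingLike.apply_eq_iff_eq,
      exists_eq_right]
    tauto
  cases a with
  | pos i => exact not_congr (key i)
  | neg i => exact key i
  | zero _ => exact Iff.rfl

/-- The factor `(-1)^|F₀|` is forced by `e_0`, which acts through the parity of the label.
`shiftSign` is chosen so that `e_i` and `e_{-i}` acquire the same factor. -/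
theorem scalar_shift (G : Finset κ) (a : Idx T κ) :
    shiftSign e F₀ G * scalar (shift e F₀ G) (a.map e) =
      (-1) ^ F₀.card * (scalar G a * shiftSign e F₀ (target G a)) := by
  have key : ∀ i, shiftSign e F₀ G * sgn (shift e F₀ G) (e i) =
      (-1) ^ F₀.card * (sgn G i * shiftSign e F₀ (toggle G i)) := fun i => by
    rw [sgn_shift, shiftSign_toggle]
    linear_combination (-shiftSign e F₀ G * sgn F₀ (e i) * sgn G i) *
      neg_one_pow_mul_self F₀.card
  cases a with
  | pos i => exact key i
  | neg i => exact key i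
  | zero _ =>
    simp only [scalar, Idx.map, target]
    rw [shift, neg_one_pow_card_symmDiff, Finset.card_map]
    ring

theorem gamma_fockMap (a : Idx T κ) (n : Fock T (e ⁻¹' (symmDiff A (F₀ : Set ℕ+)))) :
    gamma T A (a.map e) (fockMap e A F₀ T n) =
      (-1 : ℂ) ^ F₀.card • fockMap e A F₀ T (gamma T _ a n) := by
  have h : gamma T A (a.map e) ∘ₗ fockMap e A F₀ T =
      (-1 : ℂ) ^ F₀.card • fockMap e A F₀ T ∘ₗ gamma T _ a := by
    refine Finsupp.lhom_ext' (M := ℂ) fun G => LinearMap.ext_ring ?_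
    change gamma T A (a.map e) (fockMap e A F₀ T (Fock.vec T _ G)) =
      (-1 : ℂ) ^ F₀.card • fockMap e A F₀ T (gamma T _ a (Fock.vec T _ G))
    rw [fockMap_vec, map_smul, gamma_vec, gamma_vec]
    by_cases hG : Alive (e ⁻¹' (symmDiff A (F₀ : Set ℕ+))) G a
    · rw [if_pos hG, if_pos ((alive_shift G a).2 hG), map_smul, fockMap_vec, smul_smul, smul_smul,
        smul_smul, scalar_shift, target_shift, mul_assoc]
    · rw [if_neg hG, if_neg fun h => hG ((alive_shift G a).1 h), map_zero, smul_zero, smul_zero]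
  exact LinearMap.congr_fun h n

theorem psi_fockMap (v : NatMod T κ) (n : Fock T (e ⁻¹' (symmDiff A (F₀ : Set ℕ+)))) :
    psi T A (ext T e.toEmbedding v) (fockMap e A F₀ T n) =
      (-1 : ℂ) ^ F₀.card • fockMap e A F₀ T (psi T _ v n) := by
  have h : (psi T A ∘ₗ ext T e.toEmbedding).flip (fockMap e A F₀ T n) =
      (-1 : ℂ) ^ F₀.card • fockMap e A F₀ T ∘ₗ (psi T _).flip n := by
    refine Finsupp.lhom_ext' fun a => LinearMap.ext_ring ?_
    simp only [LinearMap.comp_apply, Finsupp.lsingle_apply, LinearMap.flip_apply, ext_single,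
      psi_single, LinearMap.smul_apply]
    exact gamma_fockMap a n
  exact LinearMap.congr_fun h v

/-- The action is quadratic in the Clifford generators, so the sign `(-1)^|F₀|` of `psi_fockMap`
appears twice and cancels. -/
theorem rho_fockMap (X : o T κ) (n : Fock T (e ⁻¹' (symmDiff A (F₀ : Set ℕ+)))) :
    rho T A (o.map T e.toEmbedding X) (fockMap e A F₀ T n) = fockMap e A F₀ T (rho T _ X n) := by
  let K : Submodule ℂ (o T κ) :=
    { carrier := {X | rho T A (o.map T e.toEmbedding X) (fockMap e A F₀ T n) =
        fockMap e A F₀ T (rho T _ X n)}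
      zero_mem' := by
        change ⁅o.map T e.toEmbedding 0, fockMap e A F₀ T n⁆ =
          fockMap e A F₀ T ⁅(0 : o T κ), n⁆
        rw [map_zero, zero_lie, zero_lie, map_zero]
      add_mem' := fun {X Y} hX hY => by
        change rho T A (o.map T e.toEmbedding (X + Y)) _ = fockMap e A F₀ T (rho T _ (X + Y) n)
        rw [map_add, rho_add, rho_add, LinearMap.add_apply, LinearMap.add_apply, map_add, hX, hY]
      smul_mem' := fun c X hX => by
        change rho T A (o.map T e.toEmbedding (c • X)) _ = fockMap e A F₀ T (rho T _ (c • X) n)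
        rw [map_smul, rho_smul, rho_smul, LinearMap.smul_apply, LinearMap.smul_apply, map_smul, hX] }
  refine mem_of_rootVec_mem K (fun a b => ?_) X
  change rho T A (o.map T e.toEmbedding (rootVec a b)) (fockMap e A F₀ T n) =
    fockMap e A F₀ T (rho T _ (rootVec a b) n)
  rw [rootVec, map_wedge, rho_wedge, rho_wedge]
  simp only [LinearMap.smul_apply, LinearMap.sub_apply, Module.End.mul_apply, psi_fockMap, map_smul,
    map_sub, smul_smul, neg_one_pow_mul_self, one_smul]

theorem coeff_fockMap_shift (n : Fock T (e ⁻¹' (symmDiff A (F₀ : Set ℕ+)))) (G : Finset κ) :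
    (fockMap e A F₀ T n).coeff (shift e F₀ G) = shiftSign e F₀ G * n.coeff G := by
  have h : Fock.coeffₗ T A (shift e F₀ G) ∘ₗ fockMap e A F₀ T =
      shiftSign e F₀ G • Fock.coeffₗ T _ G := by
    refine Fock.form_ext fun H => ?_
    rw [LinearMap.comp_apply, fockMap_vec, map_smul, LinearMap.smul_apply, Fock.coeffₗ_apply,
      Fock.coeffₗ_apply, Fock.coeff_vec, Fock.coeff_vec]
    by_cases hH : H = G
    · rw [hH, if_pos rfl, if_pos rfl]
    · rw [if_neg hH, if_neg fun h => hH (shift_injective h), smul_zero, smul_zero]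
  exact LinearMap.congr_fun h n

theorem coeff_fockMap_eq_zero (n : Fock T (e ⁻¹' (symmDiff A (F₀ : Set ℕ+)))) {F : Finset ℕ+}
    (hF : F ∉ Set.range (shift e F₀)) : (fockMap e A F₀ T n).coeff F = 0 := by
  have h : Fock.coeffₗ T A F ∘ₗ fockMap e A F₀ T = 0 := by
    refine Fock.form_ext fun H => ?_
    rw [LinearMap.comp_apply, fockMap_vec, map_smul, Fock.coeffₗ_apply, Fock.coeff_vec,
      if_neg fun h => hF ⟨H, h⟩, smul_zero]
    rfl
  exact LinearMap.congr_fun h n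

theorem exists_shift_of_coeff_fockMap_ne_zero {n : Fock T (e ⁻¹' (symmDiff A (F₀ : Set ℕ+)))}
    {F : Finset ℕ+} (hF : (fockMap e A F₀ T n).coeff F ≠ 0) :
    ∃ G, shift e F₀ G = F ∧ n.coeff G ≠ 0 := by
  by_cases h : F ∈ Set.range (shift e F₀)
  · obtain ⟨G, rfl⟩ := h
    rw [coeff_fockMap_shift] at hF
    exact ⟨G, rfl, right_ne_zero_of_mul hF⟩
  · exact absurd (coeff_fockMap_eq_zero n h) hF

theorem exists_fockMap_eq {m : Fock T A} (hm : ∀ F, m.coeff F ≠ 0 → F ∈ Set.range (shift e F₀)) :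
    ∃ n, fockMap e A F₀ T n = m := by
  classical
  obtain ⟨n, hn⟩ : ∃ n : Fock T (e ⁻¹' (symmDiff A (F₀ : Set ℕ+))),
      ∀ G, n.coeff G = shiftSign e F₀ G * m.coeff (shift e F₀ G) := by
    -- The signs square to `1`, so the inverse uses the same ones.
    let n : Finset κ →₀ ℂ := Finsupp.onFinset
      ((show Finset ℕ+ →₀ ℂ from m).support.preimage (shift e F₀) shift_injective.injOn)
      (fun G => shiftSign e F₀ G * m.coeff (shift e F₀ G)) fun G hG => by
        rw [Finset.mem_preimage, Finsupp.mem_support_iff]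
        exact right_ne_zero_of_mul hG
    exact ⟨n, fun _ => rfl⟩
  refine ⟨n, Fock.coeff_ext fun F => ?_⟩
  by_cases h : F ∈ Set.range (shift e F₀)
  · obtain ⟨G, rfl⟩ := h
    rw [coeff_fockMap_shift, hn, ← mul_assoc, shiftSign_mul_self, one_mul]
  · rw [coeff_fockMap_eq_zero _ h]
    by_contra h'
    exact h (hm F (Ne.symm h'))

theorem fockMap_injective : Function.Injective (fockMap e A F₀ T) := by
  intro m n h
  refine Fock.coeff_ext fun G => ?_
  have h1 := coeff_fockMap_shift m G
  rw [h, coeff_fockMap_shift] at h1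
  exact (mul_left_cancel₀ (left_ne_zero_of_mul_eq_one (shiftSign_mul_self G)) h1).symm

end Shift

/-! ### The invariants as spinor modules of `o([0])`. -/

section Iso

variable {T : SpinType} {r : ℤ → ℤ → Prop} {A : Set ℕ+}

/-- Outside `[0]`, a disagreement would give both `k ≺ 0` and `0 ≺ k`. -/
theorem mem_zeroPos_of_mem_symmDiff (hr : IsStrictOrder ℤ r) {A' A'' : Set ℕ+}
    (h' : Compatible r A') (h'' : Compatible r A'') {k : ℕ+} (hk : k ∈ symmDiff A' A'') :
    k ∈ zeroPos r := by
  rcases hk with ⟨h1, h2⟩ | ⟨h1, h2⟩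
  · rcases h'.1 k h1 with h3 | h3
    · rcases h''.2 k h2 with h4 | h4
      · exact absurd (hr.trans _ _ _ h3 h4) (hr.irrefl _)
      · exact h4
    · exact h3
  · rcases h''.1 k h1 with h3 | h3
    · rcases h'.2 k h2 with h4 | h4
      · exact absurd (hr.trans _ _ _ h3 h4) (hr.irrefl _)
      · exact h4
    · exact h3

theorem Compatible.of_symmDiff_subset {A' A'' : Set ℕ+} (h' : Compatible r A')
    (h : symmDiff A' A'' ⊆ zeroPos r) : Compatible r A'' := by
  constructor
  · intro k hk
    by_cases hk' : k ∈ A'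
    · exact h'.1 k hk'
    · exact Or.inr (h (Or.inr ⟨hk, hk'⟩))
  · intro k hk
    by_cases hk' : k ∈ A'
    · exact Or.inr (h (Or.inl ⟨hk', hk⟩))
    · exact h'.2 k hk'

theorem compatible_symmDiff_iff (hr : IsStrictOrder ℤ r) {κ : Type} [LinearOrder κ] {e : κ ↪o ℕ+}
    (he : Set.range e = zeroPos r) {F₀ : Finset ℕ+}
    (hA' : Compatible r (symmDiff A (F₀ : Set ℕ+))) (F : Finset ℕ+) :
    Compatible r (symmDiff A (F : Set ℕ+)) ↔ F ∈ Set.range (shift e F₀) := by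
  have hd : symmDiff (symmDiff A (F₀ : Set ℕ+)) (symmDiff A (F : Set ℕ+)) =
      (symmDiff F₀ F : Finset ℕ+) := by
    rw [symmDiff_comm A, symmDiff_assoc, symmDiff_symmDiff_cancel_left, Finset.coe_symmDiff]
  constructor
  · intro hF
    have hsub : ∀ k ∈ symmDiff F₀ F, k ∈ Set.range e := fun k hk => by
      rw [he]
      refine mem_zeroPos_of_mem_symmDiff hr hA' hF ?_
      rw [hd]
      exact hk
    obtain ⟨G, hG⟩ : ∃ G : Finset κ, G.map e.toEmbedding = symmDiff F₀ F := by
      refine ⟨(symmDiff F₀ F).preimage e e.injective.injOn, ?_⟩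
      ext k
      simp only [Finset.mem_map, Finset.mem_preimage]
      constructor
      · rintro ⟨i, hi, rfl⟩
        exact hi
      · intro hk
        obtain ⟨i, rfl⟩ := hsub k hk
        exact ⟨i, hk, rfl⟩
    exact ⟨G, by rw [shift, hG, symmDiff_symmDiff_cancel_left]⟩
  · rintro ⟨G, rfl⟩
    refine hA'.of_symmDiff_subset ?_
    rw [hd, shift, symmDiff_symmDiff_cancel_left, ← he]
    intro k hk
    obtain ⟨i, _, rfl⟩ := Finset.mem_map.1 (Finset.mem_coe.1 hk)
    exact ⟨i, rfl⟩

theorem even_card_shift {κ : Type} [LinearOrder κ] {e : κ ↪o ℕ+} {F₀ : Finset ℕ+}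
    (hF₀ : Even F₀.card) (G : Finset κ) : Even (shift e F₀ G).card ↔ Even G.card := by
  constructor
  · intro h
    have := even_card_symmDiff hF₀ h
    rwa [shift, symmDiff_symmDiff_cancel_left, Finset.card_map] at this
  · intro h
    exact even_card_symmDiff hF₀ (by rwa [Finset.card_map])

theorem fockMap_mem_spinor {κ : Type} [LinearOrder κ] {e : κ ↪o ℕ+} {F₀ : Finset ℕ+}
    (hF₀ : T = SpinType.D → Even F₀.card) {n : Fock T (e ⁻¹' (symmDiff A (F₀ : Set ℕ+)))} :
    fockMap e A F₀ T n ∈ Spinor T A ↔ n ∈ Spinor T (e ⁻¹' (symmDiff A (F₀ : Set ℕ+))) := by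
  constructor
  · intro h hT G hG
    refine (even_card_shift (e := e) (hF₀ hT) G).1 (h hT _ ?_)
    rw [coeff_fockMap_shift]
    exact mul_ne_zero (left_ne_zero_of_mul_eq_one (shiftSign_mul_self G)) hG
  · intro h hT F hF
    obtain ⟨G, rfl, hG⟩ := exists_shift_of_coeff_fockMap_ne_zero hF
    exact (even_card_shift (hF₀ hT) G).2 (h hT G hG)

/-- `fockMap` as a map of spinor modules. -/
def spinorMap {κ : Type} [LinearOrder κ] (e : κ ↪o ℕ+) {F₀ : Finset ℕ+}
    (hF₀ : T = SpinType.D → Even F₀.card) :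
    Spinor T (e ⁻¹' (symmDiff A (F₀ : Set ℕ+))) →ₗ[ℂ] Spinor T A :=
  (fockMap e A F₀ T).restrict (p := (Spinor T (e ⁻¹' (symmDiff A (F₀ : Set ℕ+)))).toSubmodule)
    (q := (Spinor T A).toSubmodule) fun _ hn => (fockMap_mem_spinor hF₀).2 hn

theorem coe_spinorMap {κ : Type} [LinearOrder κ] (e : κ ↪o ℕ+) {F₀ : Finset ℕ+}
    (hF₀ : T = SpinType.D → Even F₀.card)
    (n : Spinor T (e ⁻¹' (symmDiff A (F₀ : Set ℕ+)))) :
    (spinorMap e hF₀ n : Fock T A) = fockMap e A F₀ T n := rfl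

theorem lie_spinorMap {κ : Type} [LinearOrder κ] (e : κ ↪o ℕ+) {F₀ : Finset ℕ+}
    (hF₀ : T = SpinType.D → Even F₀.card) (X : o T κ)
    (n : Spinor T (e ⁻¹' (symmDiff A (F₀ : Set ℕ+)))) :
    ⁅o.map T e.toEmbedding X, spinorMap e hF₀ n⁆ = spinorMap e hF₀ ⁅X, n⁆ := by
  apply Subtype.ext
  rw [LieSubmodule.coe_bracket, coe_spinorMap, coe_spinorMap, LieSubmodule.coe_bracket, lie_def,
    lie_def, rho_fockMap]

/-- The general form of the isomorphism, for `J` finite or infinite and any compatible base point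
`A'`; the standard forms follow by choosing `A'`. -/
theorem invariantsIso_of_compatible (hr : IsStrictOrder ℤ r) (hadm : Admissible r)
    (hlin : Z2Linear r) {κ : Type} [LinearOrder κ] {e : κ ↪o ℕ+} (he : Set.range e = zeroPos r)
    {A' : Set ℕ+} (hA' : Compatible r A') (hsim : Sim T A' A) :
    InvariantsIso T r e.toEmbedding (Spinor T (e ⁻¹' A')) (Spinor T A) := by
  obtain ⟨hfin, heven⟩ := hsim
  obtain ⟨F₀, hF₀⟩ : ∃ F₀ : Finset ℕ+, A' = symmDiff A F₀ := by
    refine ⟨hfin.toFinset, ?_⟩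
    rw [Set.Finite.coe_toFinset, symmDiff_comm A' A, symmDiff_symmDiff_cancel_left]
  subst hF₀
  have hF₀even : T = SpinType.D → Even F₀.card := fun hT => by
    have := heven hT
    rwa [symmDiff_comm, symmDiff_symmDiff_cancel_left, Set.ncard_coe_finset] at this
  have hcomp : T = SpinType.D → cls r 0 = {0} →
      ∃ A' : Set ℕ+, Compatible r A' ∧ Sim T A' A := fun _ _ => ⟨_, hA', hfin, heven⟩
  have hmem : ∀ n, spinorMap e hF₀even n ∈ invariants T r (Spinor T A) := fun n =>
    mem_invariants_of_compatible hr hadm hlin fun F hF => by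
      rw [coe_spinorMap] at hF
      obtain ⟨G, rfl, -⟩ := exists_shift_of_coeff_fockMap_ne_zero hF
      exact (compatible_symmDiff_iff hr he hA' _).2 ⟨G, rfl⟩
  have hφ : Function.Bijective ((spinorMap e hF₀even).codRestrict _ hmem) := by
    constructor
    · intro m n h
      have h1 : spinorMap e hF₀even m = spinorMap e hF₀even n := congrArg Subtype.val h
      have h2 := congrArg Subtype.val h1
      rw [coe_spinorMap, coe_spinorMap] at h2
      exact Subtype.ext (fockMap_injective h2)
    · rintro ⟨m, hm⟩
      obtain ⟨n, hn⟩ := exists_fockMap_eq (T := T) (m := (m : Fock T A)) fun F hF =>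
        (compatible_symmDiff_iff hr he hA' F).1
          (compatible_of_mem_invariants hr hadm hlin hcomp hm hF)
      have hn' := (fockMap_mem_spinor hF₀even).1 (hn ▸ m.2)
      exact ⟨⟨n, hn'⟩, Subtype.ext (Subtype.ext hn)⟩
  refine ⟨LinearEquiv.ofBijective _ hφ, fun X Y hY n => ?_⟩
  have h1 : ⁅Y, spinorMap e hF₀even n⁆ = 0 := slPart_lie_eq_zero hr hadm hlin (fun F hF =>
    compatible_of_mem_invariants hr hadm hlin hcomp (hmem n) hF) hY
  have h2 := lie_spinorMap e hF₀even X n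
  change ⁅o.map T e.toEmbedding X + Y, spinorMap e hF₀even n⁆ = spinorMap e hF₀even ⁅X, n⁆
  rw [add_lie, h1, add_zero, h2]

theorem exists_orderEmbedding_range {s : Set ℕ+} (hs : s.Infinite) :
    ∃ e : ℕ+ ↪o ℕ+, Set.range e = s := by
  have := hs.to_subtype
  classical
  let f := OrderIso.pnatIsoNat
  have hs' : (f '' s).Infinite := hs.image f.injective.injOn
  have := hs'.to_subtype
  let h := Nat.Subtype.orderIsoOfNat (f '' s)
  refine ⟨(f.toOrderEmbedding.trans (h.toOrderEmbedding.trans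
    (OrderEmbedding.subtype _))).trans f.symm.toOrderEmbedding, ?_⟩
  ext k
  constructor
  · rintro ⟨i, rfl⟩
    obtain ⟨j, hj, hj'⟩ := (h (f i)).2
    change f.symm (h (f i) : ℕ) ∈ s
    rw [← hj', OrderIso.symm_apply_apply]
    exact hj
  · intro hk
    refine ⟨f.symm (h.symm ⟨f k, k, hk, rfl⟩), ?_⟩
    change f.symm (h (f (f.symm (h.symm ⟨f k, k, hk, rfl⟩))) : ℕ) = k
    rw [OrderIso.apply_symm_apply, OrderIso.apply_symm_apply, OrderIso.symm_apply_apply]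

theorem exists_orderEmbedding_fin_range {s : Set ℕ+} {n : ℕ} (hs : s.encard = n) :
    ∃ e : Fin n ↪o ℕ+, Set.range e = s := by
  have hfin : s.Finite := Set.finite_of_encard_eq_coe hs
  have hcard : hfin.toFinset.card = n := by
    rw [← Set.ncard_eq_toFinset_card _ hfin, Set.ncard, hs]
    rfl
  refine ⟨hfin.toFinset.orderEmbOfFin hcard, ?_⟩
  rw [Finset.range_orderEmbOfFin, Set.Finite.coe_toFinset]

theorem Sim.trans {A' A'' : Set ℕ+} (h : Sim T A'' A') (h' : Sim T A' A) : Sim T A'' A := by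
  have hd : symmDiff A'' A = symmDiff (symmDiff A'' A') (symmDiff A' A) := by
    rw [symmDiff_assoc, symmDiff_symmDiff_cancel_left]
  obtain ⟨h1, h2⟩ := h
  obtain ⟨h3, h4⟩ := h'
  have hcoe : symmDiff A'' A = (symmDiff h1.toFinset h3.toFinset : Finset ℕ+) := by
    rw [Finset.coe_symmDiff, h1.coe_toFinset, h3.coe_toFinset, hd]
  rw [Sim, hcoe]
  refine ⟨Finset.finite_toSet _, fun hT => ?_⟩
  rw [Set.ncard_coe_finset]
  refine even_card_symmDiff ?_ ?_
  · rw [← Set.ncard_eq_toFinset_card _ h1]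
    exact h2 hT
  · rw [← Set.ncard_eq_toFinset_card _ h3]
    exact h4 hT

/-- The base point is moved to `A' ∪ J`, which is still compatible and meets `J` in everything. The
change `J \ A'` is finite, and even in type `D`. -/
theorem invariantsIso_spinPlus (hr : IsStrictOrder ℤ r) (hadm : Admissible r)
    (hlin : Z2Linear r) {n : ℕ} {e : Fin n ↪o ℕ+} (he : Set.range e = zeroPos r)
    {A' : Set ℕ+} (hA' : Compatible r A') (hsim : Sim T A' A)
    (heven : T = SpinType.B ∨ Even (zeroPos r \ A').ncard) :
    InvariantsIso T r e.toEmbedding (spinPlus T n) (Spinor T A) := by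
  have hd : symmDiff (A' ∪ zeroPos r) A' = zeroPos r \ A' := by
    ext k
    simp only [Set.mem_symmDiff, Set.mem_union, Set.mem_sdiff]
    tauto
  have hcomp : Compatible r (A' ∪ zeroPos r) := hA'.of_symmDiff_subset (by
    rw [symmDiff_comm, hd]
    exact Set.sdiff_subset)
  have hs : Sim T (A' ∪ zeroPos r) A' := by
    rw [Sim, hd]
    refine ⟨(he ▸ Set.finite_range e).subset Set.sdiff_subset, fun hT => heven.resolve_left ?_⟩
    rintro rfl
    exact absurd hT (by simp)
  have huniv : e ⁻¹' (A' ∪ zeroPos r) = Set.univ := by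
    rw [← he]
    ext i
    simp
  have h := invariantsIso_of_compatible hr hadm hlin he hcomp (hs.trans hsim)
  rwa [huniv] at h

theorem invariantsIso_spinMinus (hr : IsStrictOrder ℤ r) (hadm : Admissible r)
    (hlin : Z2Linear r) {n : ℕ} {e : Fin n ↪o ℕ+} (he : Set.range e = zeroPos r)
    {A' : Set ℕ+} (hA' : Compatible r A') (hsim : Sim T A' A)
    (hodd : Odd (zeroPos r \ A').ncard) :
    InvariantsIso T r e.toEmbedding (spinMinus T n) (Spinor T A) := by
  have hfin : (zeroPos r \ A').Finite := (he ▸ Set.finite_range e).subset Set.sdiff_subset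
  -- An odd subset of `J` is nonempty, so `J` has a largest element. It is omitted from the new base
  -- point, which makes the change of base point even.
  obtain ⟨m, rfl⟩ : ∃ m, n = m + 1 := by
    refine Nat.exists_eq_succ_of_ne_zero ?_
    rintro rfl
    rw [← he, Set.range_eq_empty, Set.empty_sdiff, Set.ncard_empty] at hodd
    exact absurd hodd (by decide)
  set l := e (Fin.last m) with hl
  have hlJ : l ∈ zeroPos r := he ▸ Set.mem_range_self _
  have hd : symmDiff ((A' ∪ zeroPos r) \ {l}) A' = symmDiff (zeroPos r \ A') {l} := by
    ext k
    simp only [Set.mem_symmDiff, Set.mem_union, Set.mem_sdiff, Set.mem_singleton_iff]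
    by_cases hk : k = l
    · subst hk
      simp [hlJ]
    · simp only [hk]
      tauto
  have hcomp : Compatible r ((A' ∪ zeroPos r) \ {l}) := hA'.of_symmDiff_subset (by
    rw [symmDiff_comm, hd]
    rintro k (⟨hk, _⟩ | ⟨rfl, _⟩)
    · exact hk.1
    · exact hlJ)
  have hs : Sim T ((A' ∪ zeroPos r) \ {l}) A' := by
    have hcoe : symmDiff (zeroPos r \ A') {l} = (symmDiff hfin.toFinset {l} : Finset ℕ+) := by
      rw [Finset.coe_symmDiff, hfin.coe_toFinset, Finset.coe_singleton]
    rw [Sim, hd, hcoe]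
    refine ⟨Finset.finite_toSet _, fun _ => ?_⟩
    rw [Set.ncard_eq_toFinset_card _ hfin] at hodd
    rw [Set.ncard_coe_finset]
    have h := card_toggle hfin.toFinset l
    rw [hodd.neg_one_pow, neg_neg, toggle] at h
    by_contra ho
    rw [Nat.not_even_iff_odd] at ho
    rw [ho.neg_one_pow] at h
    norm_num at h
  have hpre : e ⁻¹' ((A' ∪ zeroPos r) \ {l}) = {i : Fin (m + 1) | (i : ℕ) + 1 ≠ m + 1} := by
    rw [← he, hl]
    ext i
    simp [Fin.ext_iff]
  have h := invariantsIso_of_compatible hr hadm hlin he hcomp (hs.trans hsim)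
  rwa [hpre] at h

end Iso

end OInf

end

/-! ### Assembly of the theorem. -/

theorem mainTheorem12 (T : OInf.SpinType) (A : Set ℕ+) (r : ℤ → ℤ → Prop)
    (hr : IsStrictOrder ℤ r) (hadm : OInf.Admissible r) (hlin : OInf.Z2Linear r)
    (hD : T = OInf.SpinType.D → ∀ i ∈ OInf.cls r 0, i ≠ 0 →
      ∃ j ∈ OInf.cls r 0, j ≠ 0 ∧ j ≠ i ∧ j ≠ -i)
    (hal : OInf.IsAligned T r (OInf.Spinor T A) ∨ OInf.invariants T r (OInf.Spinor T A) ≠ ⊥)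
    (hcomp : T = OInf.SpinType.D → OInf.cls r 0 = {0} →
      ∃ A' : Set ℕ+, OInf.Compatible r A' ∧ OInf.Sim T A' A) :
    (∃ A' : Set ℕ+, OInf.Compatible r A' ∧ OInf.Sim T A' A) ∧
    (∀ Y ∈ OInf.slPart T r, ∀ m ∈ OInf.invariants T r (OInf.Spinor T A), ⁅Y, m⁆ = 0) ∧
    OInf.IsDirectSum T (OInf.leviSS T r) (OInf.component T r 0) (OInf.slPart T r) ∧
    ∀ A' : Set ℕ+, OInf.Compatible r A' → OInf.Sim T A' A →
      (∀ n : ℕ, (OInf.zeroPos r).encard = n →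
        ∃ e : Fin n ↪o ℕ+, Set.range e = OInf.zeroPos r ∧
          OInf.component T r 0 = (OInf.o.map T e.toEmbedding).range ∧
          (T = OInf.SpinType.B ∨ Even (OInf.zeroPos r \ A').ncard →
            OInf.InvariantsIso T r e.toEmbedding (OInf.spinPlus T n) (OInf.Spinor T A)) ∧
          (T = OInf.SpinType.D ∧ Odd (OInf.zeroPos r \ A').ncard →
            OInf.InvariantsIso T r e.toEmbedding (OInf.spinMinus T n) (OInf.Spinor T A))) ∧
      ((OInf.zeroPos r).Infinite →
        ∃ e : ℕ+ ↪o ℕ+, Set.range e = OInf.zeroPos r ∧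
          OInf.component T r 0 = (OInf.o.map T e.toEmbedding).range ∧
          OInf.InvariantsIso T r e.toEmbedding (OInf.Spinor T (e ⁻¹' A')) (OInf.Spinor T A)) := by
  -- Either alternative of `hal` enters only through a nonzero invariant, and this only to produce
  -- one compatible set.
  have hinv : OInf.invariants T r (OInf.Spinor T A) ≠ ⊥ :=
    hal.elim (OInf.invariants_ne_bot_of_isAligned _) id
  refine ⟨OInf.exists_compatible hr hadm hlin hcomp hinv, fun Y hY m hm =>
    OInf.slPart_lie_eq_zero hr hadm hlin (fun F hF =>
      OInf.compatible_of_mem_invariants hr hadm hlin hcomp hm hF) hY,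
    OInf.isDirectSum_leviSS hr hadm hlin, fun A' hA' hsim => ⟨fun n hn => ?_, fun hinf => ?_⟩⟩
  · obtain ⟨e, he⟩ := OInf.exists_orderEmbedding_fin_range hn
    exact ⟨e, he, OInf.component_zero_eq_range he hlin hD,
      OInf.invariantsIso_spinPlus hr hadm hlin he hA' hsim,
      fun h => OInf.invariantsIso_spinMinus hr hadm hlin he hA' hsim h.2⟩
  · obtain ⟨e, he⟩ := OInf.exists_orderEmbedding_range hinf
    exact ⟨e, he, OInf.component_zero_eq_range he hlin hD,
      OInf.invariantsIso_of_compatible hr hadm hlin he hA' hsim⟩
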